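/- A (commutative) hypergroup is a set $G$ with an element $0$ and a commutative, associative operation $\boxplus$ from $G\times G$ to non-empty subsets of $G$ such that $0\boxplus x=\{x\}$, every $x$ has a unique hyperinverse $-x$ with $0\in x\boxplus(-x)$, and $x\in y\boxplus z$ if and only if $z\in x\boxplus(-y)$. A hyperfield $F$ is a hypergroup with a commutative associative multiplication with unit $1\neq 0$, such that $0x=0$, $a(x\boxplus y)=ax\boxplus ay$, and every non-zero element is invertible. It is doubly distributive if $(x\boxplus y)(z\boxplus t)=xz\boxplus xt\boxplus yz\boxplus yt$ for all $x,y,z,t\in F$. An involution of $F$ is a multiplicative map $x\mapsto\bar x$ of order dividing two with $\bar 0=0$, $\bar 1=1$ and $\overline{x\boxplus y}=\bar x\boxplus\bar y$ (for example the identity). Let $E$ be a finite set and $\underline X=\{e\in E: X(e)\ne 0\}$ for $X\in F^E$. Let $\mathcal C\subseteq F^E$ satisfy: (C0) $0\notin\mathcal C$; (C1) $\alpha X\in\mathcal C$ for $X\in\mathcal C$, $\alpha\in F\setminus\{0\}$; (C2) if $X,Y\in\mathcal C$ and $\underline X\subseteq\underline Y$, then $X=\alpha Y$ for some $\alpha\ne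 0$. Then $\mathcal C$ is the circuit set of a *weak $F$-matroid* if moreover - (C3)$'$ whenever $X,Y\in\mathcal C$ have $\underline X\neq\underline Y$, $\underline X\cup\underline Y$ does not properly contain a union of two distinct supports of members of $\mathcal C$, and $X(e)=-Y(e)\neq0$, there is $Z\in\mathcal C$ with $Z(e)=0$ and $Z(f)\in X(f)\boxplus Y(f)$ for all $f\in E$; and the circuit set of a *strong $F$-matroid* if instead - (C3) whenever $X,X_1,\dots,X_k\in\mathcal C$ have $k+1$ distinct supports whose union has height $k+1$ in the lattice of unions of supports of members of $\mathcal C$, $\underline X\not\subseteq\bigcup_i\underline X_i$, and $e_i\in(\underline X\cap\underline X_i)\setminus\bigcup_{j\ne i}\underline X_j$ satisfy $X(e_i)=-X_i(e_i)$, there is $Z\in\mathcal C$ with $Z(e_i)=0$ for all $i$ and $Z(f)\in X(f)\boxplus X_1(f)\boxplus\cdots\boxplus X_k(f)$ for all $f\in E$. Given an involution, $X\perp Y$ means $0\in\boxplus_{e\in E}X(e)\overline{Y(e)}$. For a strong $F$-matroid with circuit set $\mathcal C$, the cocircuits are the elements of minimal support among the non-zero elements of $\mathcal C^\perp$; a vector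 is an element of $F^E$ orthogonal to all cocircuits, and a covector is an element of $F^E$ orthogonal to all circuits. $F$ is *perfect* if for every strong $F$-matroid (on any finite set) every vector is orthogonal to every covector. **Theorem.** Let $F$ be a doubly distributive hyperfield. 1. $F$ is perfect (with respect to every involution of $F$, in particular the identity). 2. Weak and strong $F$-matroids coincide: for every finite set $E$, a subset of $F^E$ is the circuit set of a weak $F$-matroid if and only if it is the circuit set of a strong $F$-matroid. Moreover, the following hyperfields are doubly distributive: the Krasner hyperfield $\mathbb K=\{0,1\}$ (usual multiplication, $0\boxplus x=\{x\}$, $1\boxplus1=\{0,1\}$); the hyperfield of signs $\mathbb S=\{0,1,-1\}$ (usual multiplication, $0\boxplus x=\{x\}$, $1\boxplus1=\{1\}$, $-1\boxplus-1=\{-1\}$, $1\boxplus-1=\{0,1,-1\}$); and the tropical hyperfield $\mathbb T=\mathbb R_{\ge0}$ (usual multiplication, $a\boxplus b=\{\max(a,b)\}$ if $a\ne b$, $a\boxplus a=\{c: 0\le c\le a\}$). -/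

import Mathlib

universe u v

/-- A commutative hypergroup: a commutative associative hyperoperation with non-empty values,
neutral element, unique hyperinverses and reversibility. -/
class Hypergroup (G : Type u) extends Zero G, Neg G where
  /-- The hyperaddition `x ⊞ y`. -/
  hadd : G → G → Set G
  hadd_nonempty : ∀ x y : G, (hadd x y).Nonempty
  hadd_comm : ∀ x y : G, hadd x y = hadd y x
  hadd_assoc : ∀ x y z : G, (⋃ w ∈ hadd x y, hadd w z) = ⋃ w ∈ hadd y z, hadd x w
  zero_hadd : ∀ x : G, hadd 0 x = {x}
  /-- `-x` is the one and only `y` with `0 ∈ x ⊞ y`. -/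
  zero_mem_hadd_iff : ∀ x y : G, (0 : G) ∈ hadd x y ↔ y = -x
  mem_hadd_iff : ∀ x y z : G, x ∈ hadd y z ↔ z ∈ hadd x (-y)

/-- A commutative (Krasner-type) hyperring: multivalued addition, single-valued multiplication. -/
class Hyperring (R : Type u) extends CommMonoidWithZero R, Hypergroup R where
  mul_hadd : ∀ a x y : R, (fun w => a * w) '' hadd x y = hadd (a * x) (a * y)

/-- A hyperfield: a hyperring with `0 ≠ 1` in which every non-zero element is invertible
(with the convention `0⁻¹ = 0` for the total function `⁻¹`). -/
class Hyperfield (F : Type u) extends Hyperring F, CommGroupWithZero F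

namespace Hypergroup

variable {G : Type u} [Hypergroup G]

/-- The hypersum `x ⊞ A = ⋃_{w ∈ A} x ⊞ w` of an element and a set. -/
def haddSet (x : G) (A : Set G) : Set G := ⋃ w ∈ A, hadd x w

instance haddSet_leftCommutative : LeftCommutative (haddSet : G → Set G → Set G) where
  left_comm x y A := by
    have key : ∀ a b c : G, (⋃ w ∈ hadd b c, hadd a w) = ⋃ w ∈ hadd a c, hadd b w := by
      intro a b c
      rw [← hadd_assoc a b c, hadd_comm a b, hadd_assoc b a c]
    have key2 : ∀ a b : G, haddSet a (haddSet b A) = ⋃ c ∈ A, ⋃ w ∈ hadd b c, hadd a w := by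
      intro a b
      ext g
      simp only [haddSet, Set.mem_iUnion, exists_prop]
      constructor
      · rintro ⟨w, ⟨c, hc, hw⟩, hg⟩
        exact ⟨c, hc, w, hw, hg⟩
      · rintro ⟨c, hc, w, hw, hg⟩
        exact ⟨w, ⟨c, hc, hw⟩, hg⟩
    rw [key2 x y, key2 y x]
    simp only [key x y]

/-- The hypersum `x₁ ⊞ ⋯ ⊞ xₘ` of finitely many elements, by the recursion
`x₁ ⊞ ⋯ ⊞ xₘ = ⋃ {x₁ ⊞ w | w ∈ x₂ ⊞ ⋯ ⊞ xₘ}`; the hypersum of `x` alone is `{x}` and the empty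
hypersum is `{0}`. -/
def hsum (s : Multiset G) : Set G := s.foldr haddSet {0}

end Hypergroup

open Hypergroup

/-- `F` is doubly distributive: `(x ⊞ y)(z ⊞ t) = xz ⊞ xt ⊞ yz ⊞ yt`. -/
def IsDoublyDistributive (F : Type u) [Hyperfield F] : Prop :=
  ∀ x y z t : F,
    Set.image2 (fun a b => a * b) (hadd x y) (hadd z t) = hsum {x * z, x * t, y * z, y * t}

/-- An involution of a hyperring. -/
structure HyperInvolution (R : Type u) [Hyperring R] where
  toFun : R → R
  map_zero : toFun 0 = 0
  map_one : toFun 1 = 1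
  map_mul : ∀ x y, toFun (x * y) = toFun x * toFun y
  map_hadd : ∀ x y, toFun '' hadd x y = hadd (toFun x) (toFun y)
  involutive : Function.Involutive toFun

/-- The identity involution. -/
def HyperInvolution.refl (R : Type u) [Hyperring R] : HyperInvolution R where
  toFun x := x
  map_zero := rfl
  map_one := rfl
  map_mul _ _ := rfl
  map_hadd _ _ := Set.image_id' _
  involutive _ := rfl

section Modular

variable {E : Type v}

/-- The set of all unions of subfamilies of `S`, a lattice under inclusion. -/
def unionsOf (S : Set (Set E)) : Set (Set E) := {A | ∃ T ⊆ S, A = ⋃₀ T}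

/-- `A ≠ B` in `S` form a modular pair if `A ∪ B` does not properly contain a union of two
distinct members of `S`. -/
def IsModularPair (S : Set (Set E)) (A B : Set E) : Prop :=
  A ∈ S ∧ B ∈ S ∧ A ≠ B ∧
    ¬ ∃ A' ∈ S, ∃ B' ∈ S, A' ≠ B' ∧ A' ∪ B' ⊂ A ∪ B

/-- A family `T` of members of `S` is modular if the height of its join in the lattice of unions
of members of `S` is the size of the family. -/
def IsModularFamily (S T : Set (Set E)) : Prop :=
  T ⊆ S ∧ ∃ h : ⋃₀ T ∈ unionsOf S, Order.height (⟨⋃₀ T, h⟩ : unionsOf S) = T.encard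

end Modular

section Circuits

variable {F : Type u} [Hyperfield F] {E : Type v}

/-- The set of supports of the members of `C`. -/
def suppSet (C : Set (E → F)) : Set (Set E) := Function.support '' C

/-- The axioms common to weak and strong circuit sets: zero is not a circuit, closure under
non-zero scalars, and incomparability. -/
structure IsCircuitSystem (C : Set (E → F)) : Prop where
  zero_notMem : (fun _ => 0) ∉ C
  smul_mem : ∀ X ∈ C, ∀ α : F, α ≠ 0 → (fun e => α * X e) ∈ C
  incomparable : ∀ X ∈ C, ∀ Y ∈ C, Function.support X ⊆ Function.support Y →
    ∃ α : F, α ≠ 0 ∧ X = fun e => α * Y e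

/-- `C` is the `F`-circuit set of a weak `F`-matroid on `E`. -/
structure IsWeakMatroid (C : Set (E → F)) : Prop extends IsCircuitSystem C where
  modular_elim : ∀ X ∈ C, ∀ Y ∈ C,
    IsModularPair (suppSet C) (Function.support X) (Function.support Y) →
    ∀ e : E, X e = -Y e → X e ≠ 0 →
    ∃ Z ∈ C, Z e = 0 ∧ ∀ f : E, Z f ∈ hadd (X f) (Y f)

/-- `C` is the `F`-circuit set of a strong `F`-matroid on `E`. -/
structure IsStrongMatroid (C : Set (E → F)) : Prop extends IsCircuitSystem C where
  strong_modular_elim : ∀ (k : ℕ) (X : E → F) (Y : Fin k → E → F) (e : Fin k → E),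
    X ∈ C → (∀ i, Y i ∈ C) →
    IsModularFamily (suppSet C)
      (insert (Function.support X) (Set.range fun i => Function.support (Y i))) →
    (insert (Function.support X) (Set.range fun i => Function.support (Y i))).encard = k + 1 →
    ¬ Function.support X ⊆ ⋃ i, Function.support (Y i) →
    (∀ i, X (e i) = -Y i (e i) ∧ X (e i) ≠ 0 ∧ ∀ j, j ≠ i → Y j (e i) = 0) →
    ∃ Z ∈ C, (∀ i, Z (e i) = 0) ∧
      ∀ f : E, Z f ∈ hsum (X f ::ₘ Finset.univ.val.map fun i => Y i f)

variable [Fintype E] (τ : HyperInvolution F)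

/-- `X ⊥ Y`: zero lies in the inner product `⊞ₑ X(e) · τ(Y(e))`. -/
def Orthogonal (X Y : E → F) : Prop :=
  (0 : F) ∈ hsum (Finset.univ.val.map fun e => X e * τ.toFun (Y e))

/-- `S^⊥`. -/
def perp (S : Set (E → F)) : Set (E → F) := {X | ∀ Y ∈ S, Orthogonal τ X Y}

/-- The `F`-cocircuits: the elements of `C^⊥ \ {0}` of minimal support. -/
def cocircuits (C : Set (E → F)) : Set (E → F) :=
  {Y | MinimalFor (fun Z => Z ∈ perp τ C ∧ Z ≠ fun _ => 0) Function.support Y}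

/-- Vectors of the `F`-matroid with circuit set `C`: orthogonal to every cocircuit. -/
def vectors (C : Set (E → F)) : Set (E → F) := perp τ (cocircuits τ C)

/-- Covectors of the `F`-matroid with circuit set `C`: orthogonal to every circuit. -/
def covectors (C : Set (E → F)) : Set (E → F) := perp τ C

end Circuits

/-- `F`, with the involution `τ`, is perfect: for every strong `F`-matroid on a finite set, all
vectors are orthogonal to all covectors. -/
def IsPerfect (F : Type u) [Hyperfield F] (τ : HyperInvolution F) : Prop :=
  ∀ (E : Type v) [Fintype E] (C : Set (E → F)), IsStrongMatroid C →
    ∀ V ∈ vectors τ C, ∀ W ∈ covectors τ C, Orthogonal τ V W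

section Examples

/-- The Krasner hyperfield `K = {0, 1}` with `1 ⊞ 1 = {0, 1}`. -/
@[reducible]
def krasnerHyperfield : Hyperfield (ZMod 2) :=
  { (inferInstance : CommGroupWithZero (ZMod 2)) with
    neg := fun x => x
    hadd := fun x y => {z | x = 0 ∧ z = y ∨ y = 0 ∧ z = x ∨ x = 1 ∧ y = 1}
    hadd_nonempty := by
      intro x y
      simp only [Set.Nonempty, Set.mem_ofPred_eq]
      revert x y; decide
    hadd_comm := by
      intro x y; ext z
      simp only [Set.mem_ofPred_eq]
      revert x y z; decide
    hadd_assoc := by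
      intro x y z; ext w
      simp only [Set.mem_iUnion, Set.mem_ofPred_eq, exists_prop]
      revert x y z w
      set_option synthInstance.maxHeartbeats 400000 in set_option synthInstance.maxSize 4000 in decide
    zero_hadd := by
      intro x; ext z
      simp only [Set.mem_ofPred_eq, Set.mem_singleton_iff]
      revert x z; decide
    zero_mem_hadd_iff := by
      intro x y
      simp only [Set.mem_ofPred_eq]
      revert x y; decide
    mem_hadd_iff := by
      intro x y z
      simp only [Set.mem_ofPred_eq]
      revert x y z; decide
    mul_hadd := by
      intro a x y; ext z
      simp only [Set.mem_image, Set.mem_ofPred_eq]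
      revert a x y z; decide }

/-- The hyperfield of signs `S = {0, 1, -1}`, with `1 ⊞ 1 = {1}`, `-1 ⊞ -1 = {-1}` and
`1 ⊞ -1 = {0, 1, -1}`. -/
@[reducible]
def signHyperfield : Hyperfield SignType :=
  { (inferInstance : CommGroupWithZero SignType) with
    neg := fun x => -x
    hadd := fun x y => {z | x = 0 ∧ z = y ∨ y = 0 ∧ z = x ∨ x ≠ 0 ∧ y ≠ 0 ∧ (x = y → z = x)}
    hadd_nonempty := by
      intro x y
      simp only [Set.Nonempty, Set.mem_ofPred_eq]
      revert x y; decide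
    hadd_comm := by
      intro x y; ext z
      simp only [Set.mem_ofPred_eq]
      revert x y z; decide
    hadd_assoc := by
      intro x y z; ext w
      simp only [Set.mem_iUnion, Set.mem_ofPred_eq, exists_prop]
      revert x y z w
      set_option synthInstance.maxHeartbeats 400000 in set_option synthInstance.maxSize 4000 in decide
    zero_hadd := by
      intro x; ext z
      simp only [Set.mem_ofPred_eq, Set.mem_singleton_iff]
      revert x z; decide
    zero_mem_hadd_iff := by
      intro x y
      simp only [Set.mem_ofPred_eq]
      revert x y; decide
    mem_hadd_iff := by
      intro x y z
      simp only [Set.mem_ofPred_eq]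
      revert x y z; decide
    mul_hadd := by
      intro a x y; ext z
      simp only [Set.mem_image, Set.mem_ofPred_eq]
      revert a x y z; decide }

/-- The tropical hyperfield `T` on the non-negative reals: usual multiplication,
`a ⊞ b = {max a b}` for `a ≠ b` and `a ⊞ a = {c | c ≤ a}`. -/
@[reducible]
noncomputable def tropicalHyperfield : Hyperfield NNReal :=
  { (inferInstance : CommGroupWithZero NNReal) with
    neg := fun x => x
    hadd := fun x y => {z | x ≠ y ∧ z = max x y ∨ x = y ∧ z ≤ x}
    hadd_nonempty := by
      intro x y
      by_cases h : x = y
      · exact ⟨x, Or.inr ⟨h, le_rfl⟩⟩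
      · exact ⟨max x y, Or.inl ⟨h, rfl⟩⟩
    hadd_comm := by
      intro x y; ext z
      simp only [Set.mem_ofPred_eq]
      grind
    hadd_assoc := by
      intro x y z; ext w
      simp only [Set.mem_iUnion, Set.mem_ofPred_eq, exists_prop]
      have hx : 0 ≤ x := zero_le
      have hy : 0 ≤ y := zero_le
      have hz : 0 ≤ z := zero_le
      have h_w : 0 ≤ w := zero_le
      constructor
      · rintro ⟨v, hv, hw⟩
        by_cases hyz : y = z
        · by_cases hxw : w = x
          · exact ⟨0, by grind⟩
          · exact ⟨max x w, by grind⟩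
        · exact ⟨max y z, by grind⟩
      · rintro ⟨v, hv, hw⟩
        by_cases hyz : x = y
        · by_cases hxw : w = z
          · exact ⟨0, by grind⟩
          · exact ⟨max z w, by grind⟩
        · exact ⟨max x y, by grind⟩
    zero_hadd := by
      intro x; ext z
      simp only [Set.mem_ofPred_eq, Set.mem_singleton_iff]
      grind [zero_le, le_antisymm]
    zero_mem_hadd_iff := by
      intro x y
      simp only [Set.mem_ofPred_eq]
      grind [zero_le, le_antisymm]
    mem_hadd_iff := by
      intro x y z
      simp only [Set.mem_ofPred_eq]
      grind
    mul_hadd := by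
      intro a x y; ext z
      simp only [Set.mem_image, Set.mem_ofPred_eq]
      by_cases ha : a = 0
      · subst ha
        simp only [zero_mul, ne_eq, not_true_eq_false, false_and, true_and, false_or]
        constructor
        · rintro ⟨w, -, rfl⟩
          exact le_rfl
        · intro hz
          refine ⟨max x y, ?_, (le_antisymm hz zero_le).symm⟩
          grind
      · have hpos : 0 < a := pos_iff_ne_zero.mpr ha
        have hinj : a * x = a * y ↔ x = y := mul_right_inj' ha
        have hmax : max (a * x) (a * y) = a * max x y := (mul_max_of_nonneg x y hpos.le).symm
        rw [hmax]
        simp only [ne_eq, hinj]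
        constructor
        · rintro ⟨w, hw, rfl⟩
          rcases hw with ⟨h, rfl⟩ | ⟨h, hw⟩
          · exact Or.inl ⟨h, rfl⟩
          · exact Or.inr ⟨h, mul_le_mul_of_nonneg_left hw hpos.le⟩
        · rintro (⟨h, rfl⟩ | ⟨h, hz⟩)
          · exact ⟨max x y, Or.inl ⟨h, rfl⟩, rfl⟩
          · refine ⟨a⁻¹ * z, Or.inr ⟨h, ?_⟩, mul_inv_cancel_left₀ ha z⟩
            rw [← inv_mul_cancel_left₀ ha x]
            exact mul_le_mul_of_nonneg_left hz zero_le }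

end Examples

/-! Double distributivity says A ⊞ rA ⊆ A·(1 ⊞ r) for every hypersum A. If p, q ∈ A and 0 ∉ A,
taking r = -(p/q) forces r = -1, so p = q: a hypersum without zero is a single element
(`eq_of_mem_sum`). Two consequences carry the algebra. The set D = 1 ⊞ -1 is closed under products
and hypersums. Its multipliers O = {x : xD ⊆ D} form a valuation hyperring: u or u⁻¹ lies in O for
every u ≠ 0, and a hypersum of elements of O containing 0 lies inside D.

The combinatorics is done with tableaux closed under pivoting (`PivotSystem`). The main statement
(`perp_of_perp`) is that if all fundamental circuits and cocircuits of such a system are mutually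
orthogonal, then any V orthogonal to the cocircuits is orthogonal to any W orthogonal to the
circuits. Scaling makes V a 0-1 vector, W a vector over O, and some term V(e)W(e) equal to 1;
pivoting on entries of largest valuation gives a base whose tableau lies in O. If 1 ∉ D, both parts
of the inner product, over the base and (negated) over its complement, lie in one double hypersum T.
Either T is a single element and the parts cancel, or T ⊆ D and the total meets D, which forces 0
into it. If 1 ∈ D, then O = D, and a product of elements of D is -1 only for the factors 1 and -1,
as for signs. Non-orthogonality of V and W would then give, by a colouring lemma in the manner of
Minty and Farkas, a circuit not orthogonal to W or a cocircuit not orthogonal to V.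

For a weak matroid, modular elimination is exactly the pivot rule for fundamental circuits. What
remains is that circuits are orthogonal to fundamental cocircuits
(`IsWeakMatroid.perp_fundCocircuit`). This goes by induction on the part of the circuit off the
hyperplane: small cases are read off the pivot rule, and larger ones follow from `perp_of_perp` in a
rank-two minor whose own circuits are small.

Both assertions follow. Perfection is `perp_of_perp` for the whole matroid, since conjugated
fundamental cocircuits are cocircuits. For weak implies strong, the required circuit is a scaled
fundamental circuit for a suitable base, and its membership conditions are orthogonality relations
of X with fundamental cocircuits. -/

namespace Hypergroup

variable {G : Type u} [Hypergroup G]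

/-! ### Hypersums as sums in the monoid of subsets -/

theorem hadd_zero (x : G) : hadd x 0 = {x} := by rw [hadd_comm, zero_hadd]

instance setZero : Zero (Set G) := ⟨{0}⟩

/-- The hypersum of two sets. -/
instance setAdd : Add (Set G) := ⟨fun A B => {z | ∃ x ∈ A, ∃ y ∈ B, z ∈ hadd x y}⟩

/-- Sets in a hypergroup form a commutative monoid under the hypersum of sets. -/
instance setAddCommMonoid : AddCommMonoid (Set G) where
  nsmul := nsmulRec
  add_assoc A B C := by
    ext z
    constructor
    · rintro ⟨w, ⟨a, ha, b, hb, hw⟩, c, hc, hz⟩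
      have h : z ∈ ⋃ w ∈ hadd a b, hadd w c := Set.mem_biUnion hw hz
      rw [hadd_assoc] at h
      obtain ⟨w', hw', hz'⟩ := Set.mem_iUnion₂.1 h
      exact ⟨a, ha, w', ⟨b, hb, c, hc, hw'⟩, hz'⟩
    · rintro ⟨a, ha, w, ⟨b, hb, c, hc, hw⟩, hz⟩
      have h : z ∈ ⋃ w ∈ hadd b c, hadd a w := Set.mem_biUnion hw hz
      rw [← hadd_assoc] at h
      obtain ⟨w', hw', hz'⟩ := Set.mem_iUnion₂.1 h
      exact ⟨w', ⟨a, ha, b, hb, hw'⟩, c, hc, hz'⟩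
  zero_add A := by
    ext z
    constructor
    · rintro ⟨x, rfl, y, hy, hz⟩
      rw [zero_hadd] at hz
      rwa [Set.mem_singleton_iff.1 hz]
    · intro hz
      exact ⟨0, rfl, z, hz, by rw [zero_hadd]; rfl⟩
  add_zero A := by
    ext z
    constructor
    · rintro ⟨x, hx, y, rfl, hz⟩
      rw [hadd_zero] at hz
      rwa [Set.mem_singleton_iff.1 hz]
    · intro hz
      exact ⟨z, hz, 0, rfl, by rw [hadd_zero]; rfl⟩
  add_comm A B := by
    ext z
    constructor
    · rintro ⟨x, hx, y, hy, hz⟩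
      exact ⟨y, hy, x, hx, by rwa [hadd_comm]⟩
    · rintro ⟨x, hx, y, hy, hz⟩
      exact ⟨y, hy, x, hx, by rwa [hadd_comm]⟩

theorem mem_set_add {A B : Set G} {z : G} : z ∈ A + B ↔ ∃ x ∈ A, ∃ y ∈ B, z ∈ hadd x y := Iff.rfl

theorem set_zero_eq : (0 : Set G) = {0} := rfl

instance : IsOrderedAddMonoid (Set G) where
  add_le_add_left A B h C := by
    rintro z ⟨x, hx, y, hy, hz⟩
    exact ⟨x, h hx, y, hy, hz⟩

theorem singleton_add_singleton (x y : G) : ({x} : Set G) + {y} = hadd x y := by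
  ext z
  simp [mem_set_add]

theorem mem_singleton_add {x z : G} {A : Set G} : z ∈ {x} + A ↔ ∃ y ∈ A, z ∈ hadd x y := by
  simp [mem_set_add]

theorem zero_mem_add_iff {A B : Set G} : (0 : G) ∈ A + B ↔ ∃ x ∈ A, -x ∈ B := by
  simp only [mem_set_add, zero_mem_hadd_iff]
  constructor
  · rintro ⟨x, hx, y, hy, rfl⟩
    exact ⟨x, hx, hy⟩
  · rintro ⟨x, hx, hy⟩
    exact ⟨x, hx, _, hy, rfl⟩

theorem hsum_eq_sum (s : Multiset G) : hsum s = (s.map fun x => ({x} : Set G)).sum := by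
  induction s using Multiset.induction_on with
  | empty => rfl
  | cons a s ih =>
    have h : hsum (a ::ₘ s) = haddSet a (hsum s) := Multiset.foldr_cons _ _ _ _
    rw [h, Multiset.map_cons, Multiset.sum_cons, ← ih]
    ext z
    simp [haddSet, mem_singleton_add]

theorem hsum_map_eq_sum {ι : Type*} (s : Finset ι) (f : ι → G) :
    hsum (s.val.map f) = ∑ i ∈ s, {f i} := by
  rw [hsum_eq_sum, Multiset.map_map]
  rfl

theorem sum_singleton_nonempty (s : Multiset G) :
    ((s.map fun x => ({x} : Set G)).sum).Nonempty := by
  induction s using Multiset.induction_on with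
  | empty => exact ⟨0, rfl⟩
  | cons a s ih =>
    obtain ⟨y, hy⟩ := ih
    obtain ⟨z, hz⟩ := hadd_nonempty a y
    rw [Multiset.map_cons, Multiset.sum_cons]
    exact ⟨z, mem_singleton_add.2 ⟨y, hy, hz⟩⟩

theorem sum_nonempty {ι : Type*} (s : Finset ι) (f : ι → G) :
    (∑ i ∈ s, ({f i} : Set G)).Nonempty := by
  have h := sum_singleton_nonempty (s.val.map f)
  rwa [Multiset.map_map] at h

section Hyperring

variable {R : Type u} [Hyperring R]

theorem eq_neg_of_zero_mem {x y : R} (h : (0 : R) ∈ hadd x y) : y = -x :=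
  (zero_mem_hadd_iff x y).1 h

theorem mul_mem_hadd {a x y z : R} (h : z ∈ hadd x y) : a * z ∈ hadd (a * x) (a * y) :=
  (Hyperring.mul_hadd a x y).subset ⟨z, h, rfl⟩

instance : HasDistribNeg R where
  neg_neg x := by
    have h : (0 : R) ∈ hadd (-x) x := by
      rw [hadd_comm]
      exact (zero_mem_hadd_iff x (-x)).2 rfl
    exact (eq_neg_of_zero_mem h).symm
  neg_mul x y := by
    have h := mul_mem_hadd (a := y) ((zero_mem_hadd_iff x (-x)).2 rfl)
    rw [mul_zero] at h
    rw [mul_comm (-x), mul_comm x]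
    exact eq_neg_of_zero_mem h
  mul_neg x y := by
    have h := mul_mem_hadd (a := x) ((zero_mem_hadd_iff y (-y)).2 rfl)
    rw [mul_zero] at h
    exact eq_neg_of_zero_mem h

theorem neg_mem_hadd {x y z : R} (h : z ∈ hadd x y) : -z ∈ hadd (-x) (-y) := by
  have := mul_mem_hadd (a := -1) h
  simpa using this

theorem mul_mem_sum_multiset {s : Multiset R} {z : R} (a : R)
    (h : z ∈ (s.map fun x => ({x} : Set R)).sum) :
    a * z ∈ (s.map fun x => ({a * x} : Set R)).sum := by
  induction s using Multiset.induction_on generalizing z with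
  | empty =>
    have : z = 0 := h
    subst this
    rw [mul_zero]
    exact rfl
  | cons x s ih =>
    rw [Multiset.map_cons, Multiset.sum_cons] at h ⊢
    obtain ⟨y, hy, hz⟩ := mem_singleton_add.1 h
    exact mem_singleton_add.2 ⟨a * y, ih hy, mul_mem_hadd hz⟩

theorem mul_mem_sum {ι : Type*} {s : Finset ι} {f : ι → R} {z : R} (a : R)
    (h : z ∈ ∑ i ∈ s, ({f i} : Set R)) : a * z ∈ ∑ i ∈ s, ({a * f i} : Set R) := by
  have := mul_mem_sum_multiset (s := s.val.map f) a (by rwa [Multiset.map_map])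
  rwa [Multiset.map_map] at this

theorem neg_mem_sum {ι : Type*} {s : Finset ι} {f : ι → R} {z : R}
    (h : z ∈ ∑ i ∈ s, ({f i} : Set R)) : -z ∈ ∑ i ∈ s, ({-f i} : Set R) := by
  simpa using mul_mem_sum (-1) h

theorem mem_sum_of_forall_mem {ι : Type*} {s : Finset ι} {f : ι → R} {z : R} {A : Set R}
    (h : z ∈ ∑ i ∈ s, ({f i} : Set R)) (hA0 : (0 : R) ∈ A)
    (hA : ∀ x ∈ A, ∀ y ∈ A, hadd x y ⊆ A) (hf : ∀ i ∈ s, f i ∈ A) : z ∈ A := by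
  classical
  induction s using Finset.induction_on generalizing z with
  | empty =>
    have : z = 0 := h
    rwa [this]
  | insert i s hi ih =>
    rw [Finset.sum_insert hi] at h
    obtain ⟨y, hy, hz⟩ := mem_singleton_add.1 h
    exact hA _ (hf i (by simp)) _ (ih hy fun j hj => hf j (by simp [hj])) hz

/-- Only the terms with `f i ≠ 0` matter in a hypersum. -/
theorem sum_singleton_eq_of_subset {ι : Type*} {s t : Finset ι} (f : ι → R) (h : s ⊆ t)
    (hf : ∀ i ∈ t, i ∉ s → f i = 0) : ∑ i ∈ t, ({f i} : Set R) = ∑ i ∈ s, {f i} := by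
  refine (Finset.sum_subset h fun i hi his => ?_).symm
  rw [hf i hi his]
  rfl

end Hyperring

/-! ### The set 1 ⊞ -1 -/

section Hyperfield

variable {F : Type u} [Hyperfield F]

/-- The hypersum `1 ⊞ -1`. -/
def unitDiff (F : Type u) [Hyperfield F] : Set F := hadd (1 : F) (-1)

/-- Reversibility. In this form d is an element that 1 can absorb, which is what associativity
arguments use. -/
theorem mem_unitDiff_iff {d : F} : d ∈ unitDiff F ↔ (1 : F) ∈ hadd 1 d := by
  rw [unitDiff, hadd_comm, mem_hadd_iff, neg_neg, hadd_comm]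

theorem zero_mem_unitDiff : (0 : F) ∈ unitDiff F := (zero_mem_hadd_iff _ _).2 rfl

theorem neg_mem_unitDiff {d : F} (h : d ∈ unitDiff F) : -d ∈ unitDiff F := by
  have := neg_mem_hadd h
  rw [hadd_comm] at this
  simpa [unitDiff] using this

theorem hadd_left_assoc {a b c x z : F} (hx : x ∈ hadd b c) (hz : z ∈ hadd a x) :
    ∃ w ∈ hadd a b, z ∈ hadd w c := by
  have h : z ∈ ⋃ w ∈ hadd b c, hadd a w := Set.mem_biUnion hx hz
  rw [← hadd_assoc] at h
  simpa using h

end Hyperfield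

end Hypergroup

/-! ### Consequences of double distributivity -/

namespace IsDoublyDistributive

variable {F : Type u} [Hyperfield F] (hF : IsDoublyDistributive F)
include hF

theorem exists_mul_mem {x y r z : F}
    (h : z ∈ ({x} + {y} + ({r * x} + {r * y}) : Set F)) :
    ∃ a ∈ hadd x y, ∃ w ∈ hadd 1 r, z = a * w := by
  have h1 := hF x y 1 r
  rw [hsum_eq_sum] at h1
  have h2 : z ∈ Set.image2 (fun a b => a * b) (hadd x y) (hadd 1 r) := by
    rw [h1]
    have : (Multiset.map (fun x => ({x} : Set F)) {x * 1, x * r, y * 1, y * r}).sum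
        = {x} + {y} + ({r * x} + {r * y}) := by
      simp only [Multiset.insert_eq_cons, Multiset.map_cons, Multiset.map_singleton,
        Multiset.sum_cons, Multiset.sum_singleton, mul_one, mul_comm r]
      abel
    rw [this]
    exact h
  obtain ⟨a, ha, w, hw, rfl⟩ := h2
  exact ⟨a, ha, w, hw, rfl⟩

/-- Double distributivity with many summands on one side. The induction hypothesis writes the
contribution of the tail as x * w ∈ x ⊞ rx; the two-term law then applies to the head and x. -/
theorem exists_mul_mem_sum (s : Multiset F) {r z : F}
    (h : z ∈ (s.map fun x => ({x} : Set F)).sum + (s.map fun x => ({r * x} : Set F)).sum) :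
    ∃ x ∈ (s.map fun x => ({x} : Set F)).sum, ∃ w ∈ hadd 1 r, z = x * w := by
  induction s using Multiset.induction_on generalizing z with
  | empty =>
    obtain ⟨w, hw⟩ := hadd_nonempty 1 r
    refine ⟨0, rfl, w, hw, ?_⟩
    simp only [Multiset.map_zero, Multiset.sum_zero, add_zero] at h
    rw [zero_mul]
    exact h
  | cons a s ih =>
    simp only [Multiset.map_cons, Multiset.sum_cons] at h ⊢
    rw [add_add_add_comm] at h
    obtain ⟨p, hp, q, hq, hz⟩ := h
    obtain ⟨x, hx, w, hw, rfl⟩ := ih hq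
    have hq' : x * w ∈ ({x} + {r * x} : Set F) := by
      rw [singleton_add_singleton]
      have := mul_mem_hadd (a := x) hw
      rwa [mul_one, mul_comm x r] at this
    have hz' : z ∈ ({a} + {x} + ({r * a} + {r * x}) : Set F) := by
      rw [add_add_add_comm]
      exact ⟨p, hp, _, hq', hz⟩
    obtain ⟨b, hb, w', hw', rfl⟩ := hF.exists_mul_mem hz'
    exact ⟨b, mem_singleton_add.2 ⟨x, hx, hb⟩, w', hw', rfl⟩

/-- A hypersum that does not contain zero has only one element. -/
theorem eq_of_mem_sum (s : Multiset F) (h0 : (0 : F) ∉ (s.map fun x => ({x} : Set F)).sum)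
    {p q : F} (hp : p ∈ (s.map fun x => ({x} : Set F)).sum)
    (hq : q ∈ (s.map fun x => ({x} : Set F)).sum) : p = q := by
  have hq0 : q ≠ 0 := fun h => h0 (h ▸ hq)
  -- The factor -(p/q) sends q to -p, so zero lies in A ⊞ rA and hence is a product of an element of
  -- A and one of 1 ⊞ r. The first is non-zero, so r = -1.
  have h : (0 : F) ∈ (s.map fun x => ({x} : Set F)).sum +
      (s.map fun x => ({-(p / q) * x} : Set F)).sum := by
    refine zero_mem_add_iff.2 ⟨p, hp, ?_⟩
    have := mul_mem_sum_multiset (-(p / q)) hq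
    rwa [neg_mul, div_mul_cancel₀ _ hq0] at this
  obtain ⟨x, hx, w, hw, hxw⟩ := hF.exists_mul_mem_sum s h
  rcases mul_eq_zero.1 hxw.symm with rfl | rfl
  · exact absurd hx h0
  · have := eq_neg_of_zero_mem hw
    rw [neg_inj, div_eq_one_iff_eq hq0] at this
    exact this

theorem eq_of_mem_hadd {x y p q : F} (h : y ≠ -x) (hp : p ∈ hadd x y) (hq : q ∈ hadd x y) :
    p = q := by
  have e : ((({x, y} : Multiset F)).map fun x => ({x} : Set F)).sum = hadd x y := by
    simp [singleton_add_singleton]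
  refine hF.eq_of_mem_sum {x, y} ?_ (by rwa [e]) (by rwa [e])
  rw [e, zero_mem_hadd_iff]
  exact h

theorem hadd_eq_singleton {x y p : F} (h : y ≠ -x) (hp : p ∈ hadd x y) : hadd x y = {p} :=
  Set.eq_singleton_iff_unique_mem.2 ⟨hp, fun _ hq => hF.eq_of_mem_hadd h hq hp⟩

theorem eq_of_mem_sum_finset {ι : Type*} {s : Finset ι} {f : ι → F}
    (h0 : (0 : F) ∉ ∑ i ∈ s, ({f i} : Set F)) {p q : F} (hp : p ∈ ∑ i ∈ s, ({f i} : Set F))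
    (hq : q ∈ ∑ i ∈ s, ({f i} : Set F)) : p = q := by
  have e : ((s.val.map f).map fun x => ({x} : Set F)).sum = ∑ i ∈ s, ({f i} : Set F) := by
    rw [Multiset.map_map]; rfl
  exact hF.eq_of_mem_sum (s.val.map f) (by rwa [e]) (by rwa [e]) (by rwa [e])

theorem one_hadd {d : F} (hd : d ∈ unitDiff F) (h : d ≠ -1) : hadd 1 d = {1} :=
  hF.hadd_eq_singleton h (mem_unitDiff_iff.1 hd)

/-- For d ≠ -1 the hypersum 1 ⊞ d is {1}. Replacing d by an expression d ⊞ dd' containing it shows 1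
∈ (1 ⊞ d) ⊞ dd' = 1 ⊞ dd'. -/
theorem mul_mem_unitDiff {d d' : F} (hd : d ∈ unitDiff F) (hd' : d' ∈ unitDiff F) :
    d * d' ∈ unitDiff F := by
  by_cases h : d = -1
  · rw [h, neg_one_mul]
    exact neg_mem_unitDiff hd'
  · rw [mem_unitDiff_iff] at *
    have h1 : d ∈ hadd d (d * d') := by simpa using mul_mem_hadd (a := d) hd'
    obtain ⟨w, hw, h2⟩ := hadd_left_assoc h1 hd
    rwa [hF.eq_of_mem_hadd h hw hd] at h2

/-- Double distributivity gives (1 ⊞ -1) ⊞ (1 ⊞ -1) ⊆ (1 ⊞ -1)(1 ⊞ -1), and products stay inside by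
`mul_mem_unitDiff`. -/
theorem hadd_subset_unitDiff {x y z : F} (hx : x ∈ unitDiff F) (hy : y ∈ unitDiff F)
    (hz : z ∈ hadd x y) : z ∈ unitDiff F := by
  have h : z ∈ ({1} + {-1} + ({-1 * 1} + {-1 * -1}) : Set F) := by
    simp only [singleton_add_singleton]
    refine ⟨x, hx, y, ?_, hz⟩
    rw [hadd_comm]
    simpa [unitDiff] using hy
  obtain ⟨a, ha, w, hw, rfl⟩ := hF.exists_mul_mem h
  exact hF.mul_mem_unitDiff ha hw

end IsDoublyDistributive

/-! ### The valuation hyperring -/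

namespace Hypergroup

variable {F : Type u} [Hyperfield F]

/-- The valuation hyperring of a hyperfield: the multipliers of `1 ⊞ -1`. -/
def valuationSet (F : Type u) [Hyperfield F] : Set F := {x | ∀ d ∈ unitDiff F, x * d ∈ unitDiff F}

theorem zero_mem_valuationSet : (0 : F) ∈ valuationSet F := fun d _ => by
  rw [zero_mul]; exact zero_mem_unitDiff

theorem one_mem_valuationSet : (1 : F) ∈ valuationSet F := fun d hd => by rwa [one_mul]

theorem mul_mem_valuationSet {x y : F} (hx : x ∈ valuationSet F) (hy : y ∈ valuationSet F) :
    x * y ∈ valuationSet F := fun d hd => by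
  rw [mul_assoc]
  exact hx _ (hy _ hd)

theorem neg_mem_valuationSet {x : F} (hx : x ∈ valuationSet F) : -x ∈ valuationSet F :=
  fun d hd => by
    rw [neg_mul]
    exact neg_mem_unitDiff (hx d hd)

end Hypergroup

namespace IsDoublyDistributive

variable {F : Type u} [Hyperfield F] (hF : IsDoublyDistributive F)
include hF

theorem hadd_subset_valuationSet {x y z : F} (hx : x ∈ valuationSet F) (hy : y ∈ valuationSet F)
    (hz : z ∈ hadd x y) : z ∈ valuationSet F := fun d hd => by
  refine hF.hadd_subset_unitDiff (hx d hd) (hy d hd) ?_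
  rw [mul_comm z, mul_comm x, mul_comm y]
  exact mul_mem_hadd hz

theorem sum_subset_valuationSet {ι : Type*} {s : Finset ι} {f : ι → F}
    (hf : ∀ i ∈ s, f i ∈ valuationSet F) : ∑ i ∈ s, ({f i} : Set F) ⊆ valuationSet F :=
  fun _ hz => mem_sum_of_forall_mem hz zero_mem_valuationSet
    (fun _ hx _ hy _ h => hF.hadd_subset_valuationSet hx hy h) hf

theorem unitDiff_subset_valuationSet : unitDiff F ⊆ valuationSet F :=
  fun _ hx _ hd => hF.mul_mem_unitDiff hx hd

/-- The element a absorbs a * d. Since a ⊞ b is the single element c, associativity lets c absorb a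
* d as well. -/
theorem mul_mem_mul_unitDiff {a b c d : F} (h : c ∈ hadd a b) (hb : b ≠ -a)
    (hd : d ∈ unitDiff F) : c ∈ hadd c (a * d) := by
  have h1 : a ∈ hadd a (a * d) := by simpa using mul_mem_hadd (a := a) (mem_unitDiff_iff.1 hd)
  rw [hadd_comm] at h1 h
  obtain ⟨w, hw, h2⟩ := hadd_left_assoc (by rwa [hadd_comm] at h1) h
  have h3 : w = c := hF.eq_of_mem_hadd (fun e => hb (by rw [e, neg_neg])) hw h
  rwa [h3] at h2

/-- Totality of the valuation. Write 1 ∈ u ⊞ s. If s = -u, dividing by u puts u⁻¹ in `unitDiff F`;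
otherwise u ⊞ s = {1}, so 1 absorbs every u * d, which says that u is in the valuation hyperring. -/
theorem inv_mem_valuationSet {u : F} (h : u ∉ valuationSet F) : u⁻¹ ∈ valuationSet F := by
  have hu0 : u ≠ 0 := fun e => h (e ▸ zero_mem_valuationSet)
  by_cases hu : u⁻¹ ∈ unitDiff F
  · exact hF.unitDiff_subset_valuationSet hu
  exfalso
  have hu1 : u ≠ 1 := fun e => h (e ▸ one_mem_valuationSet)
  obtain ⟨s, hs⟩ := hadd_nonempty 1 (-u)
  have hu1' : -u ≠ -1 := fun e => hu1 (neg_injective e)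
  have hs1 : (1 : F) ∈ hadd u s := by
    rwa [hadd_comm, mem_hadd_iff, neg_neg, hadd_comm] at hs
  by_cases hsu : s = -u
  · apply hu
    have := mul_mem_hadd (a := u⁻¹) hs1
    rwa [hsu, mul_one, mul_neg, inv_mul_cancel₀ hu0] at this
  · apply h
    intro d hd
    have := hF.mul_mem_mul_unitDiff hs1 hsu hd
    rwa [mem_unitDiff_iff]

/-- A hypersum of elements of the valuation hyperring which contains zero is inside `1 ⊞ -1`. -/
theorem sum_subset_unitDiff {ι : Type*} {s : Finset ι} {f : ι → F}
    (hf : ∀ i ∈ s, f i ∈ valuationSet F) (h0 : (0 : F) ∈ ∑ i ∈ s, ({f i} : Set F)) :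
    ∑ i ∈ s, ({f i} : Set F) ⊆ unitDiff F := by
  intro z hz
  -- As 0 ∈ A, z lies in A ⊞ -A ⊆ A·(1 ⊞ -1), and A consists of multipliers of 1 ⊞ -1.
  have h : z ∈ ((s.val.map f).map fun x => ({x} : Set F)).sum +
      ((s.val.map f).map fun x => ({-1 * x} : Set F)).sum := by
    refine ⟨z, by rwa [Multiset.map_map], 0, ?_, by rw [hadd_zero]; rfl⟩
    have := mul_mem_sum (-1) h0
    rw [mul_zero] at this
    rwa [Multiset.map_map]
  obtain ⟨x, hx, w, hw, rfl⟩ := hF.exists_mul_mem_sum _ h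
  rw [Multiset.map_map] at hx
  exact hF.sum_subset_valuationSet hf hx w hw

end IsDoublyDistributive

/-! ### Dominating elements and hypersums over 1 ⊞ -1 -/

namespace IsDoublyDistributive

variable {F : Type u} [Hyperfield F] (hF : IsDoublyDistributive F)
include hF

omit hF in
theorem mem_unitDiff_of_mem_valuationSet {x : F} (h1 : (1 : F) ∈ unitDiff F)
    (hx : x ∈ valuationSet F) : x ∈ unitDiff F := by
  simpa using hx 1 h1

/-- Choice of an element of maximal valuation, possible because the valuation order is total and
transitive. -/
theorem exists_dominating {ι : Type*} (s : Finset ι) (f : ι → F) (h : ∃ i ∈ s, f i ≠ 0) :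
    ∃ i ∈ s, f i ≠ 0 ∧ ∀ j ∈ s, f j * (f i)⁻¹ ∈ valuationSet F := by
  classical
  induction s using Finset.induction_on with
  | empty => simp at h
  | insert a s ha ih =>
    by_cases hs : ∃ i ∈ s, f i ≠ 0
    · obtain ⟨i, hi, hi0, him⟩ := ih hs
      by_cases hai : f a * (f i)⁻¹ ∈ valuationSet F
      · refine ⟨i, by simp [hi], hi0, fun j hj => ?_⟩
        rcases Finset.mem_insert.1 hj with rfl | hj
        exacts [hai, him j hj]
      · have ha0 : f a ≠ 0 := fun e => hai (by rw [e, zero_mul]; exact zero_mem_valuationSet)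
        have hinv := hF.inv_mem_valuationSet hai
        refine ⟨a, by simp, ha0, fun j hj => ?_⟩
        rcases Finset.mem_insert.1 hj with rfl | hj
        · rw [mul_inv_cancel₀ ha0]; exact one_mem_valuationSet
        · have := mul_mem_valuationSet (him j hj) hinv
          have e : f j * (f i)⁻¹ * (f a * (f i)⁻¹)⁻¹ = f j * (f a)⁻¹ := by field_simp
          rwa [e] at this
    · push Not at hs
      obtain ⟨i, hi, hi0⟩ := h
      rcases Finset.mem_insert.1 hi with rfl | hi
      · refine ⟨i, by simp, hi0, fun j hj => ?_⟩
        rcases Finset.mem_insert.1 hj with rfl | hj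
        · rw [mul_inv_cancel₀ hi0]; exact one_mem_valuationSet
        · rw [hs j hj, zero_mul]; exact zero_mem_valuationSet
      · exact absurd (hs i hi) hi0

theorem one_add_sum {ι : Type*} (s : Finset ι) (f : ι → F)
    (hf : ∀ i ∈ s, f i ∈ unitDiff F ∧ f i ≠ -1) : ({1} : Set F) + ∑ i ∈ s, {f i} = {1} := by
  classical
  induction s using Finset.induction_on with
  | empty => simp
  | insert a s ha ih =>
    have h := hf a (by simp)
    rw [Finset.sum_insert ha, ← add_assoc, singleton_add_singleton, hF.one_hadd h.1 h.2]
    exact ih fun i hi => hf i (by simp [hi])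

/-- A term 1 absorbs every element of `unitDiff F` other than -1, so the hypersum is {1}. This
certifies non-orthogonality in the case 1 ∈ 1 ⊞ -1. -/
theorem zero_notMem_sum {ι : Type*} {s : Finset ι} {f : ι → F} {e : ι} (he : e ∈ s)
    (h1 : f e = 1) (hf : ∀ i ∈ s, i ≠ e → f i ∈ unitDiff F ∧ f i ≠ -1) :
    (0 : F) ∉ ∑ i ∈ s, ({f i} : Set F) := by
  classical
  rw [← Finset.add_sum_erase s _ he, h1, hF.one_add_sum]
  · simp
  · intro i hi
    exact hf i (Finset.mem_of_mem_erase hi) (Finset.ne_of_mem_erase hi)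

/-- Multiplying 1 ∈ 1 ⊞ -y by x gives x ∈ x ⊞ 1, which is {1} unless x = -1. Thus ±1 are the only
factors of -1 inside 1 ⊞ -1, as in the hyperfield of signs. -/
theorem eq_one_or_of_mul_eq {x y : F} (hx : x ∈ unitDiff F) (hy : y ∈ unitDiff F)
    (h : x * y = -1) : x = 1 ∨ x = -1 := by
  by_contra! hne
  have hx1 := hF.one_hadd hx hne.2
  have hy1 : -y ≠ -1 := by
    intro e
    rw [neg_inj.1 e, mul_one] at h
    exact hne.2 h
  have h2 := mul_mem_hadd (a := x) (mem_unitDiff_iff.1 (neg_mem_unitDiff hy))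
  rw [mul_neg, h, neg_neg, mul_one, hadd_comm, hx1] at h2
  exact hne.1 h2

theorem mul_ne_neg_one {x y : F} (hx : x ∈ unitDiff F) (hy : y ∈ unitDiff F)
    (hx1 : x ≠ -1) (hy1 : y ≠ -1) : x * y ≠ -1 := by
  intro h
  rcases hF.eq_one_or_of_mul_eq hx hy h with rfl | rfl
  · rw [one_mul] at h; exact hy1 h
  · exact hx1 rfl

end IsDoublyDistributive

/-- A family of bases with an `F`-valued tableau for each base, closed under pivoting: the entries
of the tableau after a pivot are determined up to the ambiguity of the hyperaddition. -/
structure PivotSystem (F : Type u) [Hyperfield F] (E : Type v) [DecidableEq E] where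
  bases : Set (Finset E)
  entry : Finset E → E → E → F
  pivot_mem : ∀ B ∈ bases, ∀ b ∈ B, ∀ x ∉ B, entry B b x ≠ 0 → insert x (B.erase b) ∈ bases
  entry_pivot : ∀ B ∈ bases, ∀ b ∈ B, ∀ x ∉ B, entry B b x ≠ 0 →
    entry (insert x (B.erase b)) x b = (entry B b x)⁻¹
  entry_pivot_col : ∀ B ∈ bases, ∀ b ∈ B, ∀ x ∉ B, entry B b x ≠ 0 → ∀ c ∈ B, c ≠ b →
    entry (insert x (B.erase b)) c b = entry B c x * (entry B b x)⁻¹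
  entry_pivot_row : ∀ B ∈ bases, ∀ b ∈ B, ∀ x ∉ B, entry B b x ≠ 0 → ∀ y ∉ B, y ≠ x →
    entry (insert x (B.erase b)) x y = -(entry B b y * (entry B b x)⁻¹)
  entry_pivot_mem : ∀ B ∈ bases, ∀ b ∈ B, ∀ x ∉ B, entry B b x ≠ 0 → ∀ c ∈ B, c ≠ b →
    ∀ y ∉ B, y ≠ x → entry (insert x (B.erase b)) c y ∈
      hadd (entry B c y) (-(entry B c x * entry B b y * (entry B b x)⁻¹))

/-! ### Orthogonality in pivot systems -/

namespace PivotSystem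

variable {F : Type u} [Hyperfield F] {E : Type v} [DecidableEq E] (P : PivotSystem F E)

/-- The fundamental circuit of `e ∉ B`, normalized at `e`. -/
def circuit (B : Finset E) (e : E) : E → F :=
  fun f => if f = e then 1 else if f ∈ B then P.entry B f e else 0

/-- The fundamental cocircuit of `b ∈ B`, normalized at `b`. -/
def cocircuit (B : Finset E) (b : E) : E → F :=
  fun f => if f = b then 1 else if f ∈ B then 0 else -P.entry B b f

/-- Multiply the tableau entries by `μ x / μ b`. -/
def scale (μ : E → F) (hμ : ∀ e, μ e ≠ 0) : PivotSystem F E where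
  bases := P.bases
  entry B b x := P.entry B b x * (μ x * (μ b)⁻¹)
  pivot_mem B hB b hb x hx h := P.pivot_mem B hB b hb x hx (left_ne_zero_of_mul h)
  entry_pivot B hB b hb x hx h := by
    rw [P.entry_pivot B hB b hb x hx (left_ne_zero_of_mul h)]
    simp [mul_comm]
  entry_pivot_col B hB b hb x hx h c hc hcb := by
    rw [P.entry_pivot_col B hB b hb x hx (left_ne_zero_of_mul h) c hc hcb]
    have h1 := left_ne_zero_of_mul h
    have h2 := hμ x
    have h3 := hμ b
    have h4 := hμ c
    field_simp
  entry_pivot_row B hB b hb x hx h y hy hyx := by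
    rw [P.entry_pivot_row B hB b hb x hx (left_ne_zero_of_mul h) y hy hyx]
    have h1 := left_ne_zero_of_mul h
    have h2 := hμ x
    have h3 := hμ b
    rw [neg_mul]
    congr 1
    field_simp
  entry_pivot_mem B hB b hb x hx h c hc hcb y hy hyx := by
    have := mul_mem_hadd (a := μ y * (μ c)⁻¹)
      (P.entry_pivot_mem B hB b hb x hx (left_ne_zero_of_mul h) c hc hcb y hy hyx)
    have h1 := left_ne_zero_of_mul h
    have h2 := hμ x
    have h3 := hμ b
    rw [mul_comm (P.entry _ c y), mul_comm (P.entry _ c y)]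
    convert this using 2
    rw [mul_neg]
    congr 1
    field_simp

theorem circuit_scale (μ : E → F) (hμ : ∀ e, μ e ≠ 0) (B : Finset E) (e f : E) :
    (P.scale μ hμ).circuit B e f = P.circuit B e f * (μ e * (μ f)⁻¹) := by
  unfold circuit scale
  split_ifs with h1 h2
  · rw [h1, mul_inv_cancel₀ (hμ e), one_mul]
  · rfl
  · rw [zero_mul]

theorem cocircuit_scale (μ : E → F) (hμ : ∀ e, μ e ≠ 0) (B : Finset E) (b f : E) :
    (P.scale μ hμ).cocircuit B b f = P.cocircuit B b f * (μ f * (μ b)⁻¹) := by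
  unfold cocircuit scale
  split_ifs with h1 h2
  · rw [h1, mul_inv_cancel₀ (hμ b), one_mul]
  · rw [zero_mul]
  · rw [neg_mul]

theorem neg_one_ne_zero' : (-1 : F) ≠ 0 := fun h => by
  have := congrArg Neg.neg h
  rw [neg_neg, neg_zero] at this
  exact one_ne_zero this

section Fintype

variable [Fintype E]

/-- Orthogonality to a fundamental cocircuit solved for V b: the coordinates in the base are
hyper-combinations of those outside, with the tableau row as coefficients. -/
theorem mem_sum_of_perp_cocircuit {V : E → F} {B : Finset E} {b : E} (hb : b ∈ B)
    (h : (0 : F) ∈ ∑ f, ({V f * P.cocircuit B b f} : Set F)) :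
    V b ∈ ∑ x ∈ Bᶜ, ({V x * P.entry B b x} : Set F) := by
  have e1 : ∑ f, ({V f * P.cocircuit B b f} : Set F)
      = ∑ f ∈ insert b Bᶜ, {V f * P.cocircuit B b f} := by
    refine sum_singleton_eq_of_subset _ (Finset.subset_univ _) fun i _ hi => ?_
    simp only [Finset.mem_insert, Finset.mem_compl, not_or, not_not] at hi
    simp [cocircuit, hi.1, hi.2]
  rw [e1, Finset.sum_insert (by simpa using hb), zero_mem_add_iff] at h
  obtain ⟨x, hx, h⟩ := h
  have hx' : x = V b := by simpa [cocircuit] using hx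
  have := neg_mem_sum h
  rw [neg_neg, hx'] at this
  convert this using 1
  refine Finset.sum_congr rfl fun i hi => ?_
  rw [Finset.mem_compl] at hi
  have hib : i ≠ b := fun e => hi (e ▸ hb)
  simp [cocircuit, hi, hib]

theorem mem_sum_of_circuit_perp {W : E → F} {B : Finset E} {e : E} (he : e ∉ B)
    (h : (0 : F) ∈ ∑ f, ({P.circuit B e f * W f} : Set F)) :
    -W e ∈ ∑ b ∈ B, ({P.entry B b e * W b} : Set F) := by
  have e1 : ∑ f, ({P.circuit B e f * W f} : Set F)
      = ∑ f ∈ insert e B, {P.circuit B e f * W f} := by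
    refine sum_singleton_eq_of_subset _ (Finset.subset_univ _) fun i _ hi => ?_
    simp only [Finset.mem_insert, not_or] at hi
    simp [circuit, hi.1, hi.2]
  rw [e1, Finset.sum_insert he, zero_mem_add_iff] at h
  obtain ⟨x, hx, h⟩ := h
  have hx' : x = W e := by simpa [circuit] using hx
  rw [hx'] at h
  convert h using 1
  refine Finset.sum_congr rfl fun i hi => ?_
  have hib : i ≠ e := fun h => he (h ▸ hi)
  simp [circuit, hi, hib]

/-- All entries of the tableau in the columns of `S` are in the valuation hyperring. -/
def GoodOn (S : Finset E) (B : Finset E) : Prop :=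
  B ∈ P.bases ∧ ∀ b ∈ B, ∀ x ∈ S, x ∉ B → P.entry B b x ∈ valuationSet F

variable {P}

theorem GoodOn.circuit_mem {B : Finset E} (h : P.GoodOn Finset.univ B) {e : E} (he : e ∉ B)
    (f : E) : P.circuit B e f ∈ valuationSet F := by
  unfold circuit
  split_ifs with h1 h2
  exacts [one_mem_valuationSet, h.2 f h2 e (Finset.mem_univ _) he, zero_mem_valuationSet]

theorem GoodOn.cocircuit_mem {B : Finset E} (h : P.GoodOn Finset.univ B) {b : E} (hb : b ∈ B)
    (f : E) : P.cocircuit B b f ∈ valuationSet F := by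
  unfold cocircuit
  split_ifs with h1 h2
  exacts [one_mem_valuationSet, zero_mem_valuationSet,
    neg_mem_valuationSet (h.2 b hb f (Finset.mem_univ _) h2)]

section DD

variable (hF : IsDoublyDistributive F)
include hF

omit [Fintype E] in
-- Pivoting on a dominating entry whose inverse is integral keeps the columns of S integral. The
-- column e disappears and the new column b has entries 1/p and c/p with pivot p; the other entries
-- change by integral products.
theorem GoodOn.pivot {S B : Finset E} (h : P.GoodOn S B) {b e : E} (hb : b ∈ B) (he : e ∉ B)
    (h0 : P.entry B b e ≠ 0) (hinv : (P.entry B b e)⁻¹ ∈ valuationSet F)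
    (hmax : ∀ c ∈ B, P.entry B c e * (P.entry B b e)⁻¹ ∈ valuationSet F) :
    P.GoodOn (insert e S) (insert e (B.erase b)) := by
  obtain ⟨hB, h⟩ := h
  refine ⟨P.pivot_mem B hB b hb e he h0, fun c hc x hx hxB => ?_⟩
  simp only [Finset.mem_insert, Finset.mem_erase, not_or, not_and] at hc hx hxB
  by_cases hxb : x = b
  · subst hxb
    rcases hc with rfl | ⟨hcx, hc⟩
    · rw [P.entry_pivot B hB x hb c he h0]
      exact hinv
    · rw [P.entry_pivot_col B hB x hb e he h0 c hc hcx]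
      exact hmax c hc
  · have hxB' := hxB.2 hxb
    have hxS := hx.resolve_left hxB.1
    have h1 := h b hb x hxS hxB'
    rcases hc with rfl | ⟨hcx, hc⟩
    · rw [P.entry_pivot_row B hB b hb c he h0 x hxB' hxB.1]
      exact neg_mem_valuationSet (mul_mem_valuationSet h1 hinv)
    · refine hF.hadd_subset_valuationSet (h c hc x hxS hxB') (neg_mem_valuationSet ?_)
        (P.entry_pivot_mem B hB b hb e he h0 c hc hcx x hxB' hxB.1)
      rw [mul_right_comm]
      exact mul_mem_valuationSet (hmax c hc) h1

/-- Columns are made integral one at a time by a pivot on a dominating entry of the new column. -/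
theorem exists_goodOn (hP : P.bases.Nonempty) (S : Finset E) : ∃ B, P.GoodOn S B := by
  induction S using Finset.induction_on with
  | empty =>
    obtain ⟨B, hB⟩ := hP
    exact ⟨B, hB, by simp⟩
  | insert e S he ih =>
    obtain ⟨B, hB⟩ := ih
    by_cases h : ∀ b ∈ B, e ∉ B → P.entry B b e ∈ valuationSet F
    · refine ⟨B, hB.1, fun b hb x hx hxB => ?_⟩
      rcases Finset.mem_insert.1 hx with rfl | hx
      exacts [h b hb hxB, hB.2 b hb x hx hxB]
    · push Not at h
      obtain ⟨b₀, hb₀, heB, hb₀e⟩ := h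
      obtain ⟨b, hb, h0, hmax⟩ := hF.exists_dominating B (fun b => P.entry B b e)
        ⟨b₀, hb₀, fun e0 => hb₀e (e0 ▸ zero_mem_valuationSet)⟩
      refine ⟨_, hB.pivot hF hb heB h0 ?_ hmax⟩
      -- If the inverse of the pivot were not integral, the pivot would be, and so would the entry
      -- at b₀ that it dominates.
      by_contra hinv
      have h1 := hF.inv_mem_valuationSet hinv
      rw [inv_inv] at h1
      have := mul_mem_valuationSet (hmax b₀ hb₀) h1
      rw [inv_mul_cancel_right₀ h0] at this
      exact hb₀e this

theorem GoodOn.pivot_unit {B : Finset E} (h : P.GoodOn Finset.univ B) {b e : E} (hb : b ∈ B)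
    (he : e ∉ B) (hu : P.entry B b e = 1 ∨ P.entry B b e = -1) :
    P.GoodOn Finset.univ (insert e (B.erase b)) := by
  have h1 : P.entry B b e ≠ 0 ∧ (P.entry B b e)⁻¹ ∈ valuationSet F := by
    rcases hu with hu | hu <;> rw [hu]
    · simp [one_mem_valuationSet]
    · exact ⟨neg_one_ne_zero', by simp [inv_neg, neg_mem_valuationSet one_mem_valuationSet]⟩
  have := h.pivot hF hb he h1.1 h1.2
    fun c hc => mul_mem_valuationSet (h.2 c hc e (Finset.mem_univ _) he) h1.2
  rwa [Finset.insert_eq_self.2 (Finset.mem_univ e)] at this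

theorem perp_of_goodOn_of_one_notMem {V W : E → F} {B : Finset E} {e : E}
    (h1 : (1 : F) ∉ unitDiff F) (hB : P.GoodOn Finset.univ B)
    (hV : ∀ b ∈ B, (0 : F) ∈ ∑ f, ({V f * P.cocircuit B b f} : Set F))
    (hW : ∀ e ∉ B, (0 : F) ∈ ∑ f, ({P.circuit B e f * W f} : Set F))
    (hVO : ∀ f, V f ∈ valuationSet F) (hWO : ∀ f, W f ∈ valuationSet F) (he : V e * W e = 1) :
    (0 : F) ∈ ∑ f, ({V f * W f} : Set F) := by
  -- The common value of the bilinear form: expanding V on B gives the terms over B, and expanding W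
  -- off B gives the negated terms over the complement.
  set T : Set F := ∑ p ∈ B ×ˢ Bᶜ, {W p.1 * (V p.2 * P.entry B p.1 p.2)} with hT
  have hTO : ∀ p ∈ B ×ˢ Bᶜ, W p.1 * (V p.2 * P.entry B p.1 p.2) ∈ valuationSet F := by
    rintro ⟨b, x⟩ hp
    rw [Finset.mem_product, Finset.mem_compl] at hp
    exact mul_mem_valuationSet (hWO _)
      (mul_mem_valuationSet (hVO _) (hB.2 b hp.1 x (Finset.mem_univ _) hp.2))
  have hsub1 : ∑ b ∈ B, ({V b * W b} : Set F) ≤ T := by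
    rw [hT, Finset.sum_product]
    refine Finset.sum_le_sum fun b hb => Set.singleton_subset_iff.2 ?_
    rw [mul_comm]
    exact mul_mem_sum (W b) (P.mem_sum_of_perp_cocircuit hb (hV b hb))
  have hsub2 : ∑ x ∈ Bᶜ, ({-(V x * W x)} : Set F) ≤ T := by
    rw [hT, Finset.sum_product_right]
    refine Finset.sum_le_sum fun x hx => Set.singleton_subset_iff.2 ?_
    rw [Finset.mem_compl] at hx
    rw [← mul_neg]
    convert mul_mem_sum (V x) (P.mem_sum_of_circuit_perp hx (hW x hx)) using 1
    refine Finset.sum_congr rfl fun b _ => ?_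
    rw [mul_left_comm, mul_comm (W b)]
  obtain ⟨t, ht⟩ := sum_nonempty B fun b => V b * W b
  obtain ⟨t', ht'⟩ := sum_nonempty Bᶜ fun b => V b * W b
  have htT := hsub1 ht
  have htT' := hsub2 (neg_mem_sum ht')
  by_cases h0 : (0 : F) ∈ T
  · have hTD := hF.sum_subset_unitDiff hTO h0
    obtain ⟨z, hz⟩ := hadd_nonempty t t'
    have hzD : z ∈ unitDiff F := by
      refine hF.hadd_subset_unitDiff (hTD htT) ?_ hz
      simpa using neg_mem_unitDiff (hTD htT')
    have hzS : z ∈ ∑ f, ({V f * W f} : Set F) := by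
      rw [← Finset.sum_add_sum_compl B]
      exact ⟨t, ht, t', ht', hz⟩
    -- The total is 1 ⊞ R, and z ∈ 1 ⊞ r for some r ∈ R, so r ∈ z ⊞ -1. This contains -1 because z ∈
    -- `unitDiff F`, and it has no other element because z ≠ 1. Hence r = -1 and 0 ∈ 1 ⊞ R.
    rw [← Finset.add_sum_erase _ _ (Finset.mem_univ e), he] at hzS ⊢
    obtain ⟨r, hr, hzr⟩ := mem_singleton_add.1 hzS
    have hr1 : r ∈ hadd z (-1) := by rwa [mem_hadd_iff] at hzr
    have hz1 : (-1 : F) ∈ hadd z (-1) := by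
      rw [hadd_comm]
      simpa using neg_mem_hadd (mem_unitDiff_iff.1 (neg_mem_unitDiff hzD))
    have hne : (-1 : F) ≠ -z := fun h => h1 (by rwa [← neg_inj.1 h] at hzD)
    rw [hF.eq_of_mem_hadd hne hr1 hz1] at hr
    exact zero_mem_add_iff.2 ⟨1, rfl, hr⟩
  · have h := hF.eq_of_mem_sum_finset h0 htT htT'
    rw [← Finset.sum_add_sum_compl B]
    refine zero_mem_add_iff.2 ⟨t, ht, ?_⟩
    rw [h, neg_neg]
    exact ht'

/-- The four-colour lemma for the tableaux over the residue structure, whose units are `±1`. -/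
theorem exists_circuit_or_cocircuit (h1 : (1 : F) ∈ unitDiff F) (hP : P.bases.Nonempty)
    (horth : ∀ B ∈ P.bases, ∀ e ∉ B, ∀ B' ∈ P.bases, ∀ b ∈ B',
      (0 : F) ∈ ∑ f, ({P.circuit B e f * P.cocircuit B' b f} : Set F))
    (e : E) (U : Finset E) (hU : U.Nonempty → (1 : F) ≠ -1) (C D : Finset E)
    (hcover : ∀ f, f ≠ e → f ∈ U ∨ f ∈ C ∨ f ∈ D)
    (heU : e ∉ U) (heC : e ∉ C) (heD : e ∉ D)
    (hUC : Disjoint U C) (hUD : Disjoint U D) (hCD : Disjoint C D) :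
    (∃ B, P.GoodOn Finset.univ B ∧ e ∉ B ∧
      (∀ f ∈ D, P.circuit B e f ≠ 1 ∧ P.circuit B e f ≠ -1) ∧
      ∀ f ∈ U, P.circuit B e f ≠ -1) ∨
    (∃ B, P.GoodOn Finset.univ B ∧ e ∈ B ∧
      (∀ f ∈ C, P.cocircuit B e f ≠ 1 ∧ P.cocircuit B e f ≠ -1) ∧
      ∀ f ∈ U, P.cocircuit B e f ≠ -1) := by
  induction U using Finset.induction_on generalizing C D with
  | empty =>
    clear hcover
    -- With no elements in U, take an integral base containing as many elements of C as possible. A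
    -- forbidden unit in the cocircuit of e would exchange e for an element of C and contradict
    -- maximality.
    obtain ⟨B, hB, hmax⟩ : ∃ B, P.GoodOn Finset.univ B ∧
        ∀ B', P.GoodOn Finset.univ B' → (B' ∩ C).card ≤ (B ∩ C).card := by
      obtain ⟨B₀, hB₀⟩ := exists_goodOn (P := P) hF hP Finset.univ
      obtain ⟨B, hB, hmax⟩ := Set.exists_max_image {B | P.GoodOn Finset.univ B}
        (fun B => (B ∩ C).card) (Set.toFinite _) ⟨B₀, hB₀⟩
      exact ⟨B, hB, hmax⟩
    have key : ∀ B, P.GoodOn Finset.univ B → e ∈ B →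
        (∀ B', P.GoodOn Finset.univ B' → (B' ∩ C).card ≤ (B ∩ C).card) →
        ∀ f ∈ C, P.cocircuit B e f ≠ 1 ∧ P.cocircuit B e f ≠ -1 := by
      intro B hB heB hmax f hf
      by_contra hcon
      have hfe : f ≠ e := fun h => heC (h ▸ hf)
      rw [← not_or, not_not] at hcon
      by_cases hfB : f ∈ B
      · simp only [PivotSystem.cocircuit, hfe, hfB, if_true, if_false] at hcon
        rcases hcon with h | h
        · exact zero_ne_one h
        · exact neg_one_ne_zero' h.symm
      · simp only [PivotSystem.cocircuit, hfe, hfB, if_false] at hcon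
        have hunit : P.entry B e f = 1 ∨ P.entry B e f = -1 := by
          rcases hcon with h | h
          · right; rw [← h, neg_neg]
          · left; exact neg_inj.1 h
        have h := hmax _ (hB.pivot_unit hF heB hfB hunit)
        rw [Finset.insert_inter_of_mem hf, Finset.erase_inter,
          Finset.erase_eq_of_notMem (by simp [heC]), Finset.card_insert_of_notMem
          (by simp [hfB])] at h
        omega
    by_cases heB : e ∈ B
    · exact Or.inr ⟨B, hB, heB, key B hB heB hmax, by simp⟩
    by_cases hX : ∀ f ∈ D, P.circuit B e f ≠ 1 ∧ P.circuit B e f ≠ -1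
    · exact Or.inl ⟨B, hB, heB, hX, by simp⟩
    · push Not at hX
      obtain ⟨f, hf, hX⟩ := hX
      have hunit : P.circuit B e f = 1 ∨ P.circuit B e f = -1 := by
        by_cases h : P.circuit B e f = 1
        exacts [Or.inl h, Or.inr (hX h)]
      have hfe : f ≠ e := fun h => heD (h ▸ hf)
      have hfC : f ∉ C := fun h => Finset.disjoint_left.1 hCD h hf
      have hfB : f ∈ B := by
        by_contra hfB
        simp only [PivotSystem.circuit, hfe, hfB, if_false] at hunit
        rcases hunit with h | h
        · exact zero_ne_one h
        · exact neg_one_ne_zero' h.symm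
      simp only [PivotSystem.circuit, hfe, hfB, if_false, if_true] at hunit
      have hB' := hB.pivot_unit hF hfB heB hunit
      -- Exchanging f ∈ D for e leaves the count on C unchanged, so the new base is still maximal
      -- and now contains e.
      have hcard : (insert e (B.erase f) ∩ C) = B ∩ C := by
        rw [Finset.insert_inter_of_notMem heC, Finset.erase_inter,
          Finset.erase_eq_of_notMem (by simp [hfC])]
      refine Or.inr ⟨_, hB', by simp, key _ hB' (by simp) ?_, by simp⟩
      rw [hcard]
      exact hmax
  | insert u U hu ih =>
    have hne := hU ⟨u, by simp⟩
    simp only [Finset.mem_insert, not_or] at heU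
    rw [Finset.disjoint_insert_left] at hUC hUD
    -- The element u is recoloured into C and then into D. The only pair of outcomes not settling
    -- the claim is a circuit and a cocircuit both equal to -1 at u; their product there is 1 ≠ -1,
    -- no other product is -1, and the product at e is 1, so they are not orthogonal.
    have hC := ih (fun _ => hne) (insert u C) D
      (fun f hf => by have := hcover f hf; simp only [Finset.mem_insert] at this ⊢; tauto)
      heU.2 (by simp [heU.1, heC]) heD (by simp [hu, hUC.2]) hUD.2 (by simp [hUD.1, hCD])
    have hD := ih (fun _ => hne) C (insert u D)
      (fun f hf => by have := hcover f hf; simp only [Finset.mem_insert] at this ⊢; tauto)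
      heU.2 heC (by simp [heU.1, heD]) hUC.2 (by simp [hu, hUD.2]) (by simp [hUC.1, hCD])
    rcases hC with ⟨B, hB, heB, hBD, hBU⟩ | ⟨B, hB, heB, hBC, hBU⟩
    swap
    · refine Or.inr ⟨B, hB, heB, fun f hf => hBC f (by simp [hf]), fun f hf => ?_⟩
      rcases Finset.mem_insert.1 hf with rfl | hf
      exacts [(hBC f (by simp)).2, hBU f hf]
    rcases hD with ⟨B', hB', heB', hBD', hBU'⟩ | ⟨B', hB', heB', hBC', hBU'⟩
    · refine Or.inl ⟨B', hB', heB', fun f hf => hBD' f (by simp [hf]), fun f hf => ?_⟩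
      rcases Finset.mem_insert.1 hf with rfl | hf
      exacts [(hBD' f (by simp)).2, hBU' f hf]
    by_cases hX : P.circuit B e u = -1
    swap
    · refine Or.inl ⟨B, hB, heB, hBD, fun f hf => ?_⟩
      rcases Finset.mem_insert.1 hf with rfl | hf
      exacts [hX, hBU f hf]
    by_cases hY : P.cocircuit B' e u = -1
    swap
    · refine Or.inr ⟨B', hB', heB', hBC', fun f hf => ?_⟩
      rcases Finset.mem_insert.1 hf with rfl | hf
      exacts [hY, hBU' f hf]
    exfalso
    have hXD := fun f => IsDoublyDistributive.mem_unitDiff_of_mem_valuationSet h1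
      (hB.circuit_mem heB f)
    have hYD := fun f => IsDoublyDistributive.mem_unitDiff_of_mem_valuationSet h1
      (hB'.cocircuit_mem heB' f)
    refine hF.zero_notMem_sum (Finset.mem_univ e) ?_ ?_ (horth B hB.1 e heB B' hB'.1 e heB')
    · simp [PivotSystem.circuit, PivotSystem.cocircuit]
    · intro f _ hfe
      refine ⟨hF.mul_mem_unitDiff (hXD f) (hYD f), ?_⟩
      rcases hcover f hfe with hf | hf | hf
      · rcases Finset.mem_insert.1 hf with rfl | hf
        · rw [hX, hY, neg_mul_neg, one_mul]
          exact hne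
        · exact hF.mul_ne_neg_one (hXD f) (hYD f) (hBU f hf) (hBU' f hf)
      · intro h
        rw [mul_comm] at h
        have := hBC' f hf
        have := hF.eq_one_or_of_mul_eq (hYD f) (hXD f) h
        tauto
      · intro h
        have := hBD f hf
        have := hF.eq_one_or_of_mul_eq (hXD f) (hYD f) h
        tauto

theorem perp_of_perp_of_normalized (hP : P.bases.Nonempty)
    (horth : ∀ B ∈ P.bases, ∀ e ∉ B, ∀ B' ∈ P.bases, ∀ b ∈ B',
      (0 : F) ∈ ∑ f, ({P.circuit B e f * P.cocircuit B' b f} : Set F)) {V W : E → F}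
    (hV : ∀ B ∈ P.bases, ∀ b ∈ B, (0 : F) ∈ ∑ f, ({V f * P.cocircuit B b f} : Set F))
    (hW : ∀ B ∈ P.bases, ∀ e ∉ B, (0 : F) ∈ ∑ f, ({P.circuit B e f * W f} : Set F))
    (hV01 : ∀ f, V f = 0 ∨ V f = 1) (hWO : ∀ f, W f ∈ valuationSet F) {e : E}
    (hVe : V e = 1) (hWe : W e = 1) : (0 : F) ∈ ∑ f, ({V f * W f} : Set F) := by
  have hVO : ∀ f, V f ∈ valuationSet F := fun f => by
    rcases hV01 f with h | h <;> rw [h]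
    exacts [zero_mem_valuationSet, one_mem_valuationSet]
  by_cases h1 : (1 : F) ∈ unitDiff F
  swap
  · obtain ⟨B, hB⟩ := exists_goodOn (P := P) hF hP Finset.univ
    exact perp_of_goodOn_of_one_notMem hF h1 hB (hV B hB.1) (hW B hB.1) hVO hWO
      (by rw [hVe, hWe, one_mul])
  by_contra h0
  have hOD := fun x => IsDoublyDistributive.mem_unitDiff_of_mem_valuationSet (x := x) h1
  have hWD := fun f => hOD _ (hWO f)
  -- A term -1 together with the term 1 at e would already give zero: every y ∈ O = `unitDiff F`
  -- satisfies -1 ∈ -1 ⊞ y.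
  have hprod : ∀ f, f ≠ e → V f * W f ≠ -1 := by
    intro f hfe h
    apply h0
    rw [← Finset.add_sum_erase _ _ (Finset.mem_univ e),
      ← Finset.add_sum_erase _ _ (Finset.mem_erase.2 ⟨hfe, Finset.mem_univ f⟩), h, hVe, hWe,
      one_mul]
    obtain ⟨y, hy⟩ := sum_nonempty ((Finset.univ.erase e).erase f) fun f => V f * W f
    have hyD := hOD y (hF.sum_subset_valuationSet
      (fun i _ => mul_mem_valuationSet (hVO i) (hWO i)) hy)
    refine zero_mem_add_iff.2 ⟨1, rfl, mem_singleton_add.2 ⟨y, hy, ?_⟩⟩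
    simpa using neg_mem_hadd (mem_unitDiff_iff.1 (neg_mem_unitDiff hyD))
  have hne := neg_one_ne_zero' (F := F)
  classical
  -- On U both V and W are 1, on C the entry of W is no unit, and on D the entry of V is zero. These
  -- are the colours for which the lemma's circuit has no product -1 with W, or its cocircuit none
  -- with V.
  set U := Finset.univ.filter fun f => f ≠ e ∧ V f ≠ 0 ∧ (W f = 1 ∨ W f = -1) with hUdef
  set C := Finset.univ.filter fun f => f ≠ e ∧ V f ≠ 0 ∧ ¬ (W f = 1 ∨ W f = -1) with hCdef
  set D := Finset.univ.filter fun f => f ≠ e ∧ V f = 0 with hDdef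
  have hU1 : ∀ f ∈ U, V f = 1 ∧ W f = 1 := by
    intro f hf
    simp only [hUdef, Finset.mem_filter, Finset.mem_univ, true_and] at hf
    have hVf := (hV01 f).resolve_left hf.2.1
    have := hprod f hf.1
    rw [hVf, one_mul] at this
    exact ⟨hVf, hf.2.2.resolve_right this⟩
  rcases exists_circuit_or_cocircuit hF h1 hP horth e U
    (by
      rintro ⟨f, hf⟩
      have := hprod f (by simp only [hUdef, Finset.mem_filter] at hf; exact hf.2.1)
      rwa [(hU1 f hf).1, (hU1 f hf).2, one_mul] at this)
    C D
    (by intro f hf; simp only [hUdef, hCdef, hDdef, Finset.mem_filter]; simp; tauto)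
    (by simp [hUdef]) (by simp [hCdef]) (by simp [hDdef])
    (by
      rw [Finset.disjoint_left]; intro f hf; simp only [hUdef, hCdef, Finset.mem_filter] at hf ⊢
      tauto)
    (by
      rw [Finset.disjoint_left]; intro f hf; simp only [hUdef, hDdef, Finset.mem_filter] at hf ⊢
      tauto)
    (by
      rw [Finset.disjoint_left]; intro f hf; simp only [hCdef, hDdef, Finset.mem_filter] at hf ⊢
      tauto) with ⟨B, hB, heB, hBD, hBU⟩ | ⟨B, hB, heB, hBC, hBU⟩
  · have hXD := fun f => hOD _ (hB.circuit_mem heB f)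
    refine hF.zero_notMem_sum (Finset.mem_univ e) ?_ ?_ (hW B hB.1 e heB)
    · simp [PivotSystem.circuit, hWe]
    · intro f _ hfe
      refine ⟨hF.mul_mem_unitDiff (hXD f) (hWD f), ?_⟩
      by_cases hVf : V f = 0
      · intro h
        have := hBD f (by simp [hDdef, hfe, hVf])
        have := hF.eq_one_or_of_mul_eq (hXD f) (hWD f) h
        tauto
      by_cases hWf : W f = 1 ∨ W f = -1
      · have hfU : f ∈ U := by simp [hUdef, hfe, hVf, hWf]
        rw [(hU1 f hfU).2, mul_one]
        exact hBU f hfU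
      · intro h
        rw [mul_comm] at h
        exact hWf (hF.eq_one_or_of_mul_eq (hWD f) (hXD f) h)
  · have hYD := fun f => hOD _ (hB.cocircuit_mem heB f)
    refine hF.zero_notMem_sum (Finset.mem_univ e) ?_ ?_ (hV B hB.1 e heB)
    · simp [PivotSystem.cocircuit, hVe]
    · intro f _ hfe
      refine ⟨hF.mul_mem_unitDiff (hOD _ (hVO f)) (hYD f), ?_⟩
      rcases hV01 f with hVf | hVf
      · rw [hVf, zero_mul]
        exact hne.symm
      have hVf0 : V f ≠ 0 := by rw [hVf]; exact one_ne_zero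
      rw [hVf, one_mul]
      by_cases hWf : W f = 1 ∨ W f = -1
      · exact hBU f (by simp [hUdef, hfe, hVf0, hWf])
      · refine (hBC f ?_).2
        simp only [hCdef, Finset.mem_filter, Finset.mem_univ, true_and]
        exact ⟨hfe, hVf0, hWf⟩

/-- If the circuits and cocircuits of a pivot system are orthogonal, then so are its vectors and
covectors. -/
theorem perp_of_perp (hP : P.bases.Nonempty)
    (horth : ∀ B ∈ P.bases, ∀ e ∉ B, ∀ B' ∈ P.bases, ∀ b ∈ B',
      (0 : F) ∈ ∑ f, ({P.circuit B e f * P.cocircuit B' b f} : Set F)) {V W : E → F}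
    (hV : ∀ B ∈ P.bases, ∀ b ∈ B, (0 : F) ∈ ∑ f, ({V f * P.cocircuit B b f} : Set F))
    (hW : ∀ B ∈ P.bases, ∀ e ∉ B, (0 : F) ∈ ∑ f, ({P.circuit B e f * W f} : Set F)) :
    (0 : F) ∈ ∑ f, ({V f * W f} : Set F) := by
  classical
  by_cases hex : ∃ i ∈ (Finset.univ : Finset E), V i * W i ≠ 0
  swap
  · push Not at hex
    have : ∑ f, ({V f * W f} : Set F) = ∑ f ∈ ∅, {V f * W f} :=
      sum_singleton_eq_of_subset _ (Finset.empty_subset _) fun i hi _ => hex i hi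
    rw [this]
    exact rfl
  obtain ⟨e, -, he0, hmax⟩ := hF.exists_dominating _ _ hex
  set a := V e * W e with ha
  -- V f / μ f becomes 0 or 1. The scaled W is V f * W f / a where V f ≠ 0, integral by domination;
  -- elsewhere it is 1 or 0.
  set μ : E → F := fun f => if V f ≠ 0 then V f else if W f ≠ 0 then a * (W f)⁻¹ else 1 with hμdef
  have hμ : ∀ f, μ f ≠ 0 := by
    intro f
    simp only [hμdef]
    split_ifs with h1 h2
    exacts [h1, mul_ne_zero he0 (inv_ne_zero h2), one_ne_zero]
  have hVe : V e ≠ 0 := left_ne_zero_of_mul he0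
  have hmul : ∀ f, V f * (μ f)⁻¹ * (W f * μ f * a⁻¹) = a⁻¹ * (V f * W f) := by
    intro f
    have := hμ f
    field_simp
  have key : (0 : F) ∈ ∑ f, ({V f * (μ f)⁻¹ * (W f * μ f * a⁻¹)} : Set F) := by
    refine perp_of_perp_of_normalized (P := P.scale μ hμ) hF hP ?_ (V := fun f => V f * (μ f)⁻¹)
      (W := fun f => W f * μ f * a⁻¹) ?_ ?_ ?_ ?_ (e := e) ?_ ?_
    · intro B hB e heB B' hB' b hb
      have := mul_mem_sum (μ e * (μ b)⁻¹) (horth B hB e heB B' hB' b hb)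
      rw [mul_zero] at this
      convert this using 3 with f
      rw [circuit_scale, cocircuit_scale]
      have := hμ f
      have := hμ b
      field_simp
    · intro B hB b hb
      have := mul_mem_sum ((μ b)⁻¹) (hV B hB b hb)
      rw [mul_zero] at this
      convert this using 3 with f
      rw [cocircuit_scale]
      have := hμ f
      have := hμ b
      field_simp
    · intro B hB e he
      have := mul_mem_sum (μ e * a⁻¹) (hW B hB e he)
      rw [mul_zero] at this
      convert this using 3 with f
      rw [circuit_scale]
      have := hμ f
      field_simp
    · intro f
      by_cases h : V f = 0
      · left; simp [h]
      · right; simp [hμdef, h]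
    · intro f
      by_cases h : V f = 0
      · by_cases h2 : W f = 0
        · simp [h2, zero_mem_valuationSet]
        · have : W f * μ f * a⁻¹ = 1 := by
            simp only [hμdef, h, h2, ne_eq, not_true_eq_false, not_false_eq_true, if_true, if_false]
            field_simp
          rw [this]
          exact one_mem_valuationSet
      · have := hmax f (Finset.mem_univ f)
        simpa [hμdef, h, mul_comm] using this
    · simp [hμdef, hVe]
    · have : μ e = V e := by simp [hμdef, hVe]
      rw [this, mul_comm (W e), mul_inv_cancel₀ he0]
  simp only [hmul] at key
  have := mul_mem_sum a key
  simpa [mul_inv_cancel_left₀ he0] using this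

end DD
end Fintype
end PivotSystem

/-! ### Bases and fundamental circuits of weak matroids -/

section CircuitSystem

variable {F : Type u} [Hyperfield F] {E : Type v}

theorem IsCircuitSystem.exists_ne_zero {C : Set (E → F)} (hC : IsCircuitSystem C) {X : E → F}
    (hX : X ∈ C) : ∃ e, X e ≠ 0 := by
  by_contra! h
  exact hC.zero_notMem ((funext h : X = fun _ => 0) ▸ hX)

theorem IsCircuitSystem.eq_smul {C : Set (E → F)} (hC : IsCircuitSystem C) {X Y : E → F}
    (hX : X ∈ C) (hY : Y ∈ C) (h : ∀ f, X f ≠ 0 → Y f ≠ 0) :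
    ∃ α : F, α ≠ 0 ∧ ∀ e, X e = α * Y e := by
  obtain ⟨α, hα, e⟩ := hC.incomparable X hX Y hY h
  exact ⟨α, hα, congrFun e⟩

theorem support_smul_eq {α : F} (hα : α ≠ 0) (X : E → F) :
    Function.support (fun e => α * X e) = Function.support X := by
  ext e
  simp [hα]

/-- Elimination for a pair of circuits that is modular, with an arbitrary scaling factor. -/
theorem IsWeakMatroid.exists_elim_of_isModularPair {C : Set (E → F)} (hC : IsWeakMatroid C)
    {X Y : E → F} (hX : X ∈ C) (hY : Y ∈ C)
    (hXY : IsModularPair (suppSet C) (Function.support X) (Function.support Y)) {e : E}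
    (hXe : X e ≠ 0) (hYe : Y e ≠ 0) :
    ∃ Z ∈ C, Z e = 0 ∧ ∀ f, Z f ∈ hadd (X f) (-(Y f * X e * (Y e)⁻¹)) := by
  have hα : -(X e * (Y e)⁻¹) ≠ 0 := by
    intro h
    rw [← neg_zero, neg_inj] at h
    exact mul_ne_zero hXe (inv_ne_zero hYe) h
  obtain ⟨Z, hZ, hZe, h⟩ := hC.modular_elim X hX _ (hC.smul_mem Y hY _ hα)
    (by rwa [support_smul_eq hα]) e (by rw [neg_mul, neg_neg, inv_mul_cancel_right₀ hYe]) hXe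
  refine ⟨Z, hZ, hZe, fun f => ?_⟩
  convert h f using 1
  rw [neg_mul]
  congr 2
  rw [mul_assoc, mul_comm]

theorem eq_zero_of_mem_hadd {x y z : F} (h : z ∈ hadd x y) (hx : x = 0) (hy : y = 0) : z = 0 := by
  rw [hx, hy, zero_hadd] at h
  exact h

/-- Circuit elimination for the supports of the circuits of a weak matroid. -/
theorem IsWeakMatroid.exists_elim [Finite E] {C : Set (E → F)} (hC : IsWeakMatroid C)
    {X Y : E → F} (hX : X ∈ C) (hY : Y ∈ C) (hXY : Function.support X ≠ Function.support Y) {e : E}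
    (hXe : X e ≠ 0) (hYe : Y e ≠ 0) : ∃ Z ∈ C, Z e = 0 ∧ ∀ f, Z f ≠ 0 → X f ≠ 0 ∨ Y f ≠ 0 := by
  induction h : (Function.support X ∪ Function.support Y).ncard using Nat.strong_induction_on
    generalizing X Y with
  | _ n ih =>
    -- A non-modular pair has a pair of distinct circuits with strictly smaller union. Either one of
    -- them misses e already, or the induction applies to that pair.
    by_cases hmod : IsModularPair (suppSet C) (Function.support X) (Function.support Y)
    · obtain ⟨Z, hZ, hZe, hf⟩ := hC.exists_elim_of_isModularPair hX hY hmod hXe hYe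
      refine ⟨Z, hZ, hZe, fun f hZf => ?_⟩
      by_contra! hcon
      exact hZf (eq_zero_of_mem_hadd (hf f) hcon.1 (by rw [hcon.2]; simp))
    · simp only [IsModularPair, not_and, not_not] at hmod
      obtain ⟨_, ⟨X', hX', rfl⟩, _, ⟨Y', hY', rfl⟩, hne, hss⟩ :=
        hmod ⟨X, hX, rfl⟩ ⟨Y, hY, rfl⟩ hXY
      have hsub : ∀ f, X' f ≠ 0 ∨ Y' f ≠ 0 → X f ≠ 0 ∨ Y f ≠ 0 := fun f hf => hss.1 hf
      by_cases hX'e : X' e = 0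
      · exact ⟨X', hX', hX'e, fun f hf => hsub f (Or.inl hf)⟩
      by_cases hY'e : Y' e = 0
      · exact ⟨Y', hY', hY'e, fun f hf => hsub f (Or.inr hf)⟩
      obtain ⟨Z, hZ, hZe, hf⟩ := ih _ (h ▸ Set.ncard_lt_ncard hss (Set.toFinite _)) hX' hY' hne
        hX'e hY'e rfl
      exact ⟨Z, hZ, hZe, fun f h => hsub f (hf f h)⟩

/-- A base of a circuit system: it contains no circuit, and each element outside is in a circuit
which is otherwise inside. -/
structure IsBase [DecidableEq E] (C : Set (E → F)) (B : Finset E) : Prop where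
  indep : ∀ X ∈ C, ∃ f, X f ≠ 0 ∧ f ∉ B
  exists_circuit : ∀ x ∉ B, ∃ X ∈ C, X x = 1 ∧ ∀ f, X f ≠ 0 → f ∈ insert x B

open Classical in
/-- The fundamental circuit of `x ∉ B` with respect to a base `B`, normalized at `x`. -/
noncomputable def fundCircuit (C : Set (E → F)) (B : Finset E) (x : E) : E → F :=
  if h : x ∉ B ∧ ∃ X ∈ C, X x = 1 ∧ ∀ f, X f ≠ 0 → f = x ∨ f ∈ B then h.2.choose else 0

/-- The fundamental cocircuit of `b ∈ B` with respect to a base `B`, normalized at `b`. -/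
noncomputable def fundCocircuit [DecidableEq E] (C : Set (E → F)) (B : Finset E) (b : E) : E → F :=
  fun f => if f = b then 1 else -fundCircuit C B f b

theorem fundCircuit_of_mem (C : Set (E → F)) {B : Finset E} {x : E} (hx : x ∈ B) :
    fundCircuit C B x = 0 := dif_neg (by simp [hx])

theorem fundCocircuit_self [DecidableEq E] (C : Set (E → F)) (B : Finset E) (b : E) :
    fundCocircuit C B b b = 1 := if_pos rfl

theorem fundCocircuit_of_mem [DecidableEq E] (C : Set (E → F)) {B : Finset E} {b x : E}
    (hx : x ∈ B) (hxb : x ≠ b) : fundCocircuit C B b x = 0 := by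
  simp [fundCocircuit, hxb, fundCircuit_of_mem C hx]

theorem IsCircuitSystem.exists_isBase [Finite E] [DecidableEq E] {C : Set (E → F)}
    (hC : IsCircuitSystem C) {I : Finset E} (hI : ∀ X ∈ C, ∃ f, X f ≠ 0 ∧ f ∉ I) :
    ∃ B, IsBase C B ∧ I ⊆ B := by
  obtain ⟨B, ⟨hB, hIB⟩, hmax⟩ := Set.exists_max_image
    {B : Finset E | (∀ X ∈ C, ∃ f, X f ≠ 0 ∧ f ∉ B) ∧ I ⊆ B} Finset.card (Set.toFinite _)
    ⟨I, hI, subset_rfl⟩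
  refine ⟨B, ⟨hB, fun x hx => ?_⟩, hIB⟩
  by_contra! hcon
  have h1 : insert x B ∈ {B : Finset E | (∀ X ∈ C, ∃ f, X f ≠ 0 ∧ f ∉ B) ∧ I ⊆ B} := by
    refine ⟨fun X hX => ?_, hIB.trans (Finset.subset_insert _ _)⟩
    by_contra! hXB
    have hXx : X x ≠ 0 := by
      intro h0
      obtain ⟨f, hf, hfB⟩ := hB X hX
      rcases Finset.mem_insert.1 (hXB f hf) with rfl | h
      exacts [hf h0, hfB h]
    obtain ⟨f, hf, hfB⟩ := hcon _ (hC.smul_mem X hX _ (inv_ne_zero hXx)) (inv_mul_cancel₀ hXx)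
    exact hfB (hXB f (right_ne_zero_of_mul hf))
  have := hmax _ h1
  rw [Finset.card_insert_of_notMem hx] at this
  omega

namespace IsBase

variable [DecidableEq E] {C : Set (E → F)} {B : Finset E} (hB : IsBase C B)
include hB

theorem fundCircuit_spec {x : E} (hx : x ∉ B) : fundCircuit C B x ∈ C ∧ fundCircuit C B x x = 1 ∧
    ∀ f, fundCircuit C B x f ≠ 0 → f ∈ insert x B := by
  simp only [Finset.mem_insert]
  have h : x ∉ B ∧ ∃ X ∈ C, X x = 1 ∧ ∀ f, X f ≠ 0 → f = x ∨ f ∈ B := by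
    simpa only [Finset.mem_insert] using And.intro hx (hB.exists_circuit x hx)
  rw [fundCircuit, dif_pos h]
  exact h.2.choose_spec

theorem fundCircuit_eq_zero {x f : E} (hfx : f ≠ x) (hf : f ∉ B) : fundCircuit C B x f = 0 := by
  by_cases hx : x ∈ B
  · rw [fundCircuit_of_mem C hx]; rfl
  · by_contra h
    rcases Finset.mem_insert.1 ((hB.fundCircuit_spec hx).2.2 f h) with h | h
    exacts [hfx h, hf h]

variable [Finite E] (hC : IsWeakMatroid C)
include hC

/-- If the supports differed, eliminating x would leave a circuit inside the base. -/
theorem eq_fundCircuit {x : E} {X : E → F} (hX : X ∈ C)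
    (hXx : X x = 1) (h : ∀ f, X f ≠ 0 → f ∈ insert x B) (hx : x ∉ B) : X = fundCircuit C B x := by
  obtain ⟨h1, h2, h3⟩ := hB.fundCircuit_spec hx
  have hsupp : Function.support X = Function.support (fundCircuit C B x) := by
    by_contra hne
    obtain ⟨Z, hZ, hZx, hf⟩ := hC.exists_elim hX h1 hne (e := x) (by rw [hXx]; exact one_ne_zero)
      (by rw [h2]; exact one_ne_zero)
    obtain ⟨f, hZf, hfB⟩ := hB.indep Z hZ
    have : f ∈ insert x B := by
      rcases hf f hZf with h' | h'
      exacts [h f h', h3 f h']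
    rcases Finset.mem_insert.1 this with rfl | h'
    exacts [hZf hZx, hfB h']
  obtain ⟨α, -, hα⟩ := hC.eq_smul hX h1 hsupp.subset
  have h4 := hα x
  rw [hXx, h2, mul_one] at h4
  ext f
  rw [hα, ← h4, one_mul]

theorem eq_mul_fundCircuit {x : E} {X : E → F} (hX : X ∈ C)
    (h : ∀ f, X f ≠ 0 → f ∈ insert x B) (hx : x ∉ B) :
    X x ≠ 0 ∧ ∀ f, X f = X x * fundCircuit C B x f := by
  have hXx : X x ≠ 0 := by
    intro h0
    obtain ⟨f, hf, hfB⟩ := hB.indep X hX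
    rcases Finset.mem_insert.1 (h f hf) with rfl | h'
    exacts [hf h0, hfB h']
  refine ⟨hXx, fun f => ?_⟩
  rw [← hB.eq_fundCircuit hC (hC.smul_mem X hX _ (inv_ne_zero hXx)) (inv_mul_cancel₀ hXx)
    (fun f hf => h f (right_ne_zero_of_mul hf)) hx, mul_inv_cancel_left₀ hXx]

theorem exchange {b x : E} (hb : b ∈ B) (hx : x ∉ B) (h : fundCircuit C B x b ≠ 0) :
    IsBase C (insert x (B.erase b)) := by
  obtain ⟨h1, h2, h3⟩ := hB.fundCircuit_spec hx
  have hbx : b ≠ x := fun e => hx (e ▸ hb)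
  refine ⟨fun X hX => ?_, fun y hy => ?_⟩
  · by_contra! hXB
    have := hB.eq_mul_fundCircuit hC hX (x := x)
      (fun f hf => by
        have := hXB f hf
        simp only [Finset.mem_insert, Finset.mem_erase] at this ⊢
        tauto) hx
    have h4 : X b ≠ 0 := by
      rw [this.2]
      exact mul_ne_zero this.1 h
    simpa [hbx] using hXB b h4
  · by_cases hyb : y = b
    · subst hyb
      refine ⟨_, hC.smul_mem _ h1 _ (inv_ne_zero h), inv_mul_cancel₀ h, fun f hf => ?_⟩
      have := h3 f (right_ne_zero_of_mul hf)
      simp only [Finset.mem_insert, Finset.mem_erase] at this ⊢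
      tauto
    · simp only [Finset.mem_insert, Finset.mem_erase, not_or, not_and] at hy
      have hyB := hy.2 hyb
      obtain ⟨g1, g2, g3⟩ := hB.fundCircuit_spec hyB
      by_cases hg : fundCircuit C B y b = 0
      · refine ⟨_, g1, g2, fun f hf => ?_⟩
        have := g3 f hf
        have : f ≠ b := fun e => hf (e ▸ hg)
        simp only [Finset.mem_insert, Finset.mem_erase] at *
        tauto
      · have hne : Function.support (fundCircuit C B y) ≠ Function.support (fundCircuit C B x) := by
          intro e
          have hy' : y ∈ Function.support (fundCircuit C B y) := by
            rw [Function.mem_support, g2]; exact one_ne_zero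
          rw [e] at hy'
          have := h3 y hy'
          simp only [Finset.mem_insert] at this
          tauto
        obtain ⟨Z, hZ, hZb, hf⟩ := hC.exists_elim g1 h1 hne hg h
        have hZy : Z y ≠ 0 := by
          intro h0
          have hZB : ∀ f, Z f ≠ 0 → f ∈ insert x B := by
            intro f hf'
            have hfy : f ≠ y := fun e => hf' (e ▸ h0)
            have a1 := g3 f
            have a2 := h3 f
            have a3 := hf f hf'
            simp only [Finset.mem_insert] at *
            tauto
          have := hB.eq_mul_fundCircuit hC hZ hZB hx
          rw [this.2] at hZb
          exact mul_ne_zero this.1 h hZb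
        refine ⟨_, hC.smul_mem Z hZ _ (inv_ne_zero hZy), inv_mul_cancel₀ hZy, fun f hf' => ?_⟩
        have hf' := right_ne_zero_of_mul hf'
        have a1 := g3 f
        have a2 := h3 f
        have a3 := hf f hf'
        have a4 : f ≠ b := fun e => hf' (e ▸ hZb)
        simp only [Finset.mem_insert, Finset.mem_erase] at *
        tauto

/-- X and Y are distinct circuits in B + x + y. One of them, or the result of eliminating y between
them, avoids y and so is a multiple of the fundamental circuit of x. -/
theorem support_fundCircuit_subset {x y : E} (hx : x ∉ B) {X Y : E → F} (hX : X ∈ C)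
    (hY : Y ∈ C) (hXY : Function.support X ≠ Function.support Y)
    (hXB : ∀ f, X f ≠ 0 → f ∈ insert x (insert y B))
    (hYB : ∀ f, Y f ≠ 0 → f ∈ insert x (insert y B)) {f : E} (hf : fundCircuit C B x f ≠ 0) :
    X f ≠ 0 ∨ Y f ≠ 0 := by
  have key : ∀ Z ∈ C, Z y = 0 → (∀ f, Z f ≠ 0 → f ∈ insert x (insert y B)) → Z f ≠ 0 := by
    intro Z hZ hZy hZB
    have := hB.eq_mul_fundCircuit hC hZ (x := x) (fun f hf => by
      have hfy : f ≠ y := fun e => hf (e ▸ hZy)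
      have := hZB f hf
      simp only [Finset.mem_insert] at this ⊢
      tauto) hx
    rw [this.2]
    exact mul_ne_zero this.1 hf
  by_cases hXy : X y = 0
  · exact Or.inl (key X hX hXy hXB)
  by_cases hYy : Y y = 0
  · exact Or.inr (key Y hY hYy hYB)
  obtain ⟨Z, hZ, hZy, hZf⟩ := hC.exists_elim hX hY hXY hXy hYy
  refine hZf f (key Z hZ hZy fun f hf => ?_)
  rcases hZf f hf with h | h
  exacts [hXB f h, hYB f h]

/-- Any two distinct circuits inside the union cover both fundamental circuits by
`support_fundCircuit_subset`, so no smaller union exists. -/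
theorem isModularPair {x y : E} (hx : x ∉ B) (hy : y ∉ B) (hxy : x ≠ y) :
    IsModularPair (suppSet C) (Function.support (fundCircuit C B x))
      (Function.support (fundCircuit C B y)) := by
  obtain ⟨h1, h2, h3⟩ := hB.fundCircuit_spec hx
  obtain ⟨g1, g2, g3⟩ := hB.fundCircuit_spec hy
  refine ⟨⟨_, h1, rfl⟩, ⟨_, g1, rfl⟩, fun e => ?_, ?_⟩
  · have hx' : x ∈ Function.support (fundCircuit C B x) := by
      rw [Function.mem_support, h2]; exact one_ne_zero
    rw [e, Function.mem_support] at hx'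
    exact hx' (hB.fundCircuit_eq_zero hxy hx)
  · rintro ⟨_, ⟨X, hX, rfl⟩, _, ⟨Y, hY, rfl⟩, hne, hss⟩
    have hsub : ∀ f, X f ≠ 0 ∨ Y f ≠ 0 → f ∈ insert x (insert y B) := by
      intro f hf
      rcases hss.1 hf with h | h
      · have := h3 f h
        simp only [Finset.mem_insert] at this ⊢
        tauto
      · have := g3 f h
        simp only [Finset.mem_insert] at this ⊢
        tauto
    refine hss.2 fun f hf => ?_
    rcases hf with hf | hf
    · exact hB.support_fundCircuit_subset hC hx hX hY hne (fun f h => hsub f (Or.inl h))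
        (fun f h => hsub f (Or.inr h)) hf
    · refine hB.support_fundCircuit_subset hC (y := x) hy hX hY hne (fun f h => ?_)
        (fun f h => ?_) hf
      · rw [Finset.insert_comm]; exact hsub f (Or.inl h)
      · rw [Finset.insert_comm]; exact hsub f (Or.inr h)

/-- The pivot rule is modular elimination: removing b between the fundamental circuits of y and x
gives, by uniqueness, the fundamental circuit of y for the new base. -/
theorem fundCircuit_exchange_mem {b x y : E} (hb : b ∈ B) (hx : x ∉ B)
    (h : fundCircuit C B x b ≠ 0) (hy : y ∉ B) (hyx : y ≠ x) (f : E) :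
    fundCircuit C (insert x (B.erase b)) y f ∈ hadd (fundCircuit C B y f)
      (-(fundCircuit C B x f * fundCircuit C B y b * (fundCircuit C B x b)⁻¹)) := by
  have hB' := hB.exchange hC hb hx h
  obtain ⟨h1, h2, h3⟩ := hB.fundCircuit_spec hx
  obtain ⟨g1, g2, g3⟩ := hB.fundCircuit_spec hy
  have hyB' : y ∉ insert x (B.erase b) := by simp [hy, hyx]
  by_cases hyb : fundCircuit C B y b = 0
  · rw [← hB'.eq_fundCircuit hC g1 g2 (fun f hf => ?_) hyB', hyb, mul_zero, zero_mul, neg_zero,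
      hadd_zero]
    · rfl
    · have := g3 f hf
      have : f ≠ b := fun e => hf (e ▸ hyb)
      simp only [Finset.mem_insert, Finset.mem_erase] at *
      tauto
  · obtain ⟨Z, hZ, hZb, hf⟩ := hC.exists_elim_of_isModularPair g1 h1
      (hB.isModularPair hC hy hx hyx) hyb h
    have hZy : Z y = 1 := by
      have := hf y
      rwa [g2, hB.fundCircuit_eq_zero hyx hy, zero_mul, zero_mul, neg_zero, hadd_zero] at this
    rw [← hB'.eq_fundCircuit hC hZ hZy (fun f hZf => ?_) hyB']
    · exact hf f
    · by_contra hfB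
      have hfb : f ≠ b := fun e => hZf (e ▸ hZb)
      simp only [Finset.mem_insert, Finset.mem_erase, not_or, not_and] at hfB
      refine hZf (eq_zero_of_mem_hadd (hf f) (hB.fundCircuit_eq_zero hfB.1 (hfB.2.2 hfb)) ?_)
      rw [hB.fundCircuit_eq_zero hfB.2.1 (hfB.2.2 hfb), zero_mul, zero_mul, neg_zero]

theorem fundCircuit_exchange_self {b x : E} (hb : b ∈ B) (hx : x ∉ B)
    (h : fundCircuit C B x b ≠ 0) (f : E) :
    fundCircuit C (insert x (B.erase b)) b f = fundCircuit C B x f * (fundCircuit C B x b)⁻¹ := by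
  have hB' := hB.exchange hC hb hx h
  have hbx : b ≠ x := fun e => hx (e ▸ hb)
  obtain ⟨h1, h2, h3⟩ := hB.fundCircuit_spec hx
  rw [← hB'.eq_fundCircuit hC (hC.smul_mem _ h1 _ (inv_ne_zero h)) (inv_mul_cancel₀ h)
    (fun f hf => ?_) (by simp [hbx]), mul_comm]
  have := h3 f (right_ne_zero_of_mul hf)
  simp only [Finset.mem_insert, Finset.mem_erase] at this ⊢
  tauto

theorem fundCircuit_exchange_new {b x y : E} (hb : b ∈ B) (hx : x ∉ B)
    (h : fundCircuit C B x b ≠ 0) (hy : y ∉ B) (hyx : y ≠ x) :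
    fundCircuit C (insert x (B.erase b)) y x =
      -(fundCircuit C B y b * (fundCircuit C B x b)⁻¹) := by
  have := hB.fundCircuit_exchange_mem hC hb hx h hy hyx x
  rwa [hB.fundCircuit_eq_zero hyx.symm hx, zero_hadd, (hB.fundCircuit_spec hx).2.1, one_mul] at this

/-- The cocircuit of `B - b` depends on the choice of `b` only up to a scalar. -/
theorem fundCocircuit_exchange {b x : E} (hb : b ∈ B) (hx : x ∉ B)
    (h : fundCircuit C B x b ≠ 0) (f : E) :
    fundCocircuit C (insert x (B.erase b)) x f =
      fundCocircuit C B b f * (fundCocircuit C B b x)⁻¹ := by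
  have hbx : b ≠ x := fun e => hx (e ▸ hb)
  have hxb : fundCocircuit C B b x = -fundCircuit C B x b := if_neg hbx.symm
  by_cases hfx : f = x
  · subst hfx
    rw [fundCocircuit_self, mul_inv_cancel₀]
    rw [hxb]
    intro h0
    rw [← neg_zero, neg_inj] at h0
    exact h h0
  have e1 : fundCocircuit C (insert x (B.erase b)) x f =
    -fundCircuit C (insert x (B.erase b)) f x := if_neg hfx
  rw [e1, hxb]
  by_cases hfb : f = b
  · subst hfb
    rw [hB.fundCircuit_exchange_self hC hb hx h, (hB.fundCircuit_spec hx).2.1, fundCocircuit_self,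
      inv_neg]
    simp
  · have e2 : fundCocircuit C B b f = -fundCircuit C B f b := if_neg hfb
    rw [e2]
    by_cases hfB : f ∈ B
    · rw [fundCircuit_of_mem C hfB, fundCircuit_of_mem]
      · simp
      · simp [hfB, hfb]
    · rw [hB.fundCircuit_exchange_new hC hb hx h hfB hfx, inv_neg, neg_mul_neg, neg_neg]

end IsBase

end CircuitSystem

/-! ### Circuits are orthogonal to fundamental cocircuits -/

section Orthogonality

variable {F : Type u} [Hyperfield F] {E : Type v} [DecidableEq E]

theorem insert_erase_map_union {E' : Type*} [DecidableEq E'] (ι : E' ↪ E) {L : Finset E}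
    (hL : ∀ e, ι e ∉ L) (B : Finset E') (b x : E') :
    (insert x (B.erase b)).map ι ∪ L = insert (ι x) ((B.map ι ∪ L).erase (ι b)) := by
  rw [Finset.map_insert, Finset.map_erase, Finset.insert_union, Finset.erase_union_distrib,
    Finset.erase_eq_of_notMem (hL b)]

theorem map_mem_union_iff {E' : Type*} (ι : E' ↪ E) {L : Finset E}
    (hL : ∀ e, ι e ∉ L) (B : Finset E') (b : E') : ι b ∈ B.map ι ∪ L ↔ b ∈ B := by
  simp [hL]

variable [Fintype E] {C : Set (E → F)} (hC : IsWeakMatroid C)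

/-- The tableaux of the minor of a weak matroid obtained by contracting `L` and restricting to the
range of `ι`, for bases with `k` elements. -/
noncomputable def IsWeakMatroid.minorSystem (hC : IsWeakMatroid C) {E' : Type*} [DecidableEq E']
    (ι : E' ↪ E) (L : Finset E) (hL : ∀ e, ι e ∉ L) (k : ℕ) : PivotSystem F E' where
  bases := {B | IsBase C (B.map ι ∪ L) ∧ B.card = k}
  entry B b x := fundCircuit C (B.map ι ∪ L) (ι x) (ι b)
  pivot_mem B hB b hb x hx h := by
    refine ⟨?_, ?_⟩
    · rw [insert_erase_map_union ι hL]
      exact hB.1.exchange hC (by rwa [map_mem_union_iff ι hL]) (by rwa [map_mem_union_iff ι hL]) h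
    · rw [Finset.card_insert_of_notMem (by simp [hx]), Finset.card_erase_add_one hb, hB.2]
  entry_pivot B hB b hb x hx h := by
    rw [insert_erase_map_union ι hL, hB.1.fundCircuit_exchange_self hC
      (by rwa [map_mem_union_iff ι hL]) (by rwa [map_mem_union_iff ι hL]) h,
      (hB.1.fundCircuit_spec (by rwa [map_mem_union_iff ι hL])).2.1, one_mul]
  entry_pivot_col B hB b hb x hx h c hc hcb := by
    rw [insert_erase_map_union ι hL, hB.1.fundCircuit_exchange_self hC
      (by rwa [map_mem_union_iff ι hL]) (by rwa [map_mem_union_iff ι hL]) h]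
  entry_pivot_row B hB b hb x hx h y hy hyx := by
    rw [insert_erase_map_union ι hL, hB.1.fundCircuit_exchange_new hC
      (by rwa [map_mem_union_iff ι hL]) (by rwa [map_mem_union_iff ι hL]) h
      (by rwa [map_mem_union_iff ι hL]) (ι.injective.ne hyx)]
  entry_pivot_mem B hB b hb x hx h c hc hcb y hy hyx := by
    rw [insert_erase_map_union ι hL]
    exact hB.1.fundCircuit_exchange_mem hC
      (by rwa [map_mem_union_iff ι hL]) (by rwa [map_mem_union_iff ι hL]) h
      (by rwa [map_mem_union_iff ι hL]) (ι.injective.ne hyx) _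

variable {E' : Type*} [Fintype E'] [DecidableEq E']

omit [DecidableEq E] [DecidableEq E'] in
theorem sum_comp_embedding (ι : E' ↪ E) {g : E → F} (hg : ∀ f, f ∉ Set.range ι → g f = 0) :
    ∑ f, ({g (ι f)} : Set F) = ∑ f, {g f} := by
  rw [← Finset.sum_map Finset.univ ι fun f => ({g f} : Set F)]
  refine (sum_singleton_eq_of_subset _ (Finset.subset_univ _) fun i _ hi => hg i ?_).symm
  simpa using hi

include hC in
/-- Vectors and covectors of a minor of a weak matroid are orthogonal if its circuits and
cocircuits are. -/
theorem IsWeakMatroid.perp_of_minor (hF : IsDoublyDistributive F) (ι : E' ↪ E) (L : Finset E)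
    (hL : ∀ e, ι e ∉ L) (k : ℕ) (hne : ∃ B : Finset E', IsBase C (B.map ι ∪ L) ∧ B.card = k)
    (horth : ∀ B : Finset E', IsBase C (B.map ι ∪ L) → B.card = k → ∀ e ∉ B,
      ∀ B' : Finset E', IsBase C (B'.map ι ∪ L) → B'.card = k → ∀ b ∈ B',
      (0 : F) ∈ ∑ f, ({fundCircuit C (B.map ι ∪ L) (ι e) f *
        fundCocircuit C (B'.map ι ∪ L) (ι b) f} : Set F))
    {V W : E → F} (hV0 : ∀ f, f ∉ Set.range ι → f ∉ L → V f = 0) (hW0 : ∀ f ∈ L, W f = 0)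
    (hV : ∀ B : Finset E', IsBase C (B.map ι ∪ L) → B.card = k → ∀ b ∈ B,
      (0 : F) ∈ ∑ f, ({V f * fundCocircuit C (B.map ι ∪ L) (ι b) f} : Set F))
    (hW : ∀ B : Finset E', IsBase C (B.map ι ∪ L) → B.card = k → ∀ e ∉ B,
      (0 : F) ∈ ∑ f, ({fundCircuit C (B.map ι ∪ L) (ι e) f * W f} : Set F)) :
    (0 : F) ∈ ∑ f, ({V f * W f} : Set F) := by
  have hcirc : ∀ B : Finset E', IsBase C (B.map ι ∪ L) → ∀ e ∉ B, ∀ f,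
      (hC.minorSystem ι L hL k).circuit B e f = fundCircuit C (B.map ι ∪ L) (ι e) (ι f) := by
    intro B hB e he f
    rw [← map_mem_union_iff ι hL] at he
    unfold PivotSystem.circuit IsWeakMatroid.minorSystem
    split_ifs with h1 h2
    · rw [h1, (hB.fundCircuit_spec he).2.1]
    · rfl
    · rw [← map_mem_union_iff ι hL] at h2
      rw [hB.fundCircuit_eq_zero (ι.injective.ne h1) h2]
  have hcocirc : ∀ B : Finset E', IsBase C (B.map ι ∪ L) → ∀ b ∈ B, ∀ f,
      (hC.minorSystem ι L hL k).cocircuit B b f =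
        fundCocircuit C (B.map ι ∪ L) (ι b) (ι f) := by
    intro B hB b hb f
    unfold PivotSystem.cocircuit IsWeakMatroid.minorSystem
    split_ifs with h1 h2
    · rw [h1, fundCocircuit_self]
    · rw [← map_mem_union_iff ι hL] at h2
      rw [fundCocircuit_of_mem C h2 (ι.injective.ne h1)]
    · exact (if_neg (ι.injective.ne h1)).symm
  have hcirc0 : ∀ B : Finset E', IsBase C (B.map ι ∪ L) → ∀ e, ∀ f, f ∉ Set.range ι → f ∉ L →
      fundCircuit C (B.map ι ∪ L) (ι e) f = 0 := by
    intro B hB e f hf hfL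
    refine hB.fundCircuit_eq_zero (fun h => hf ⟨e, h.symm⟩) ?_
    rw [Finset.mem_union, not_or]
    refine ⟨fun h => ?_, hfL⟩
    obtain ⟨b, -, rfl⟩ := Finset.mem_map.1 h
    exact hf ⟨b, rfl⟩
  have hcocirc0 : ∀ B : Finset E', ∀ b, ∀ f ∈ L,
      fundCocircuit C (B.map ι ∪ L) (ι b) f = 0 := fun B b f hf =>
    fundCocircuit_of_mem C (Finset.mem_union_right _ hf) fun h => hL b (h ▸ hf)
  have h1 : ∀ {X Y : E → F}, (∀ f, f ∉ Set.range ι → f ∉ L → X f = 0) → (∀ f ∈ L, Y f = 0) →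
      ∑ f, ({X (ι f) * Y (ι f)} : Set F) = ∑ f, {X f * Y f} := by
    intro X Y hX hY
    refine sum_comp_embedding ι (g := fun f => X f * Y f) fun f hf => ?_
    by_cases hfL : f ∈ L
    · rw [hY f hfL, mul_zero]
    · rw [hX f hf hfL, zero_mul]
  rw [← h1 hV0 hW0]
  refine PivotSystem.perp_of_perp (P := hC.minorSystem ι L hL k) hF hne ?_
    (V := fun f => V (ι f)) (W := fun f => W (ι f)) ?_ ?_
  · rintro B ⟨hB, hBk⟩ e he B' ⟨hB', hBk'⟩ b hb
    simp only [hcirc B hB e he, hcocirc B' hB' b hb]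
    rw [h1 (hcirc0 B hB e) (hcocirc0 B' b)]
    exact horth B hB hBk e he B' hB' hBk' b hb
  · rintro B ⟨hB, hBk⟩ b hb
    simp only [hcocirc B hB b hb]
    rw [h1 hV0 (hcocirc0 B b)]
    exact hV B hB hBk b hb
  · rintro B ⟨hB, hBk⟩ e he
    simp only [hcirc B hB e he]
    rw [h1 (hcirc0 B hB e) hW0]
    exact hW B hB hBk e he

include hC in
-- The start of the induction. If X has one element off B it is a multiple of a fundamental circuit.
-- If it has two, x and y, a pivot bringing y into the base makes X a multiple of the new
-- fundamental circuit of x, and the pivot rule at b is the required relation.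
theorem IsWeakMatroid.perp_fundCocircuit_of_card_le_two {X : E → F} (hX : X ∈ C) {B : Finset E}
    (hB : IsBase C B) {b : E} (hb : b ∈ B) {x y : E} (hx : x ∉ B) (hy : y ∉ B)
    (hXB : ∀ f, X f ≠ 0 → f ∈ insert x (insert y B)) :
    (0 : F) ∈ ∑ f, ({X f * fundCocircuit C B b f} : Set F) := by
  have hbx : b ≠ x := fun e => hx (e ▸ hb)
  have hby : b ≠ y := fun e => hy (e ▸ hb)
  have hc : ∀ z, z ≠ b → fundCocircuit C B b z = -fundCircuit C B z b := fun z hz => if_neg hz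
  by_cases hone : ∃ z ∉ B, ∀ f, X f ≠ 0 → f ∈ insert z B
  · obtain ⟨z, hz, hXz⟩ := hone
    have hbz : b ≠ z := fun e => hz (e ▸ hb)
    have h := hB.eq_mul_fundCircuit hC hX hXz hz
    have e1 : ∑ f, ({X f * fundCocircuit C B b f} : Set F)
        = ∑ f ∈ {b, z}, {X f * fundCocircuit C B b f} := by
      refine sum_singleton_eq_of_subset _ (Finset.subset_univ _) fun i _ hi => ?_
      simp only [Finset.mem_insert, Finset.mem_singleton, not_or] at hi
      by_cases hiB : i ∈ B
      · rw [fundCocircuit_of_mem C hiB hi.1, mul_zero]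
      · rw [h.2 i, hB.fundCircuit_eq_zero hi.2 hiB, mul_zero, zero_mul]
    rw [e1, Finset.sum_pair hbz, zero_mem_add_iff]
    refine ⟨_, rfl, ?_⟩
    rw [fundCocircuit_self, mul_one, hc z hbz.symm, mul_neg, h.2 b]
    rfl
  push Not at hone
  have hXx : X x ≠ 0 := by
    obtain ⟨f, hf, hfy⟩ := hone y hy
    have := hXB f hf
    rw [Finset.mem_insert] at this
    rwa [this.resolve_right hfy] at hf
  have hXy : X y ≠ 0 := by
    obtain ⟨f, hf, hfy⟩ := hone x hx
    have := hXB f hf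
    rw [Finset.insert_comm, Finset.mem_insert] at this
    rwa [this.resolve_right hfy] at hf
  have hxy : x ≠ y := by
    rintro rfl
    obtain ⟨f, hf, hfx⟩ := hone x hx
    exact hfx (by simpa using hXB f hf)
  have e1 : ∑ f, ({X f * fundCocircuit C B b f} : Set F)
      = ∑ f ∈ {b, x, y}, {X f * fundCocircuit C B b f} := by
    refine sum_singleton_eq_of_subset _ (Finset.subset_univ _) fun i _ hi => ?_
    simp only [Finset.mem_insert, Finset.mem_singleton, not_or] at hi
    by_cases hiB : i ∈ B
    · rw [fundCocircuit_of_mem C hiB hi.1, mul_zero]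
    · have : X i = 0 := by
        by_contra h
        have := hXB i h
        simp only [Finset.mem_insert] at this
        tauto
      rw [this, zero_mul]
  obtain ⟨g1, g2, g3⟩ := hB.fundCircuit_spec hy
  -- The pivot is at a zero of X, so that X lies in the new base plus x. Without such a c,
  -- incomparability would make X proportional to the fundamental circuit of y, which vanishes at x.
  obtain ⟨c, hc0, hXc⟩ : ∃ c, fundCircuit C B y c ≠ 0 ∧ X c = 0 := by
    by_contra! hcon
    obtain ⟨α, hα, hαX⟩ := hC.eq_smul g1 hX hcon
    have := hαX x
    rw [hB.fundCircuit_eq_zero hxy hx] at this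
    exact mul_ne_zero hα hXx this.symm
  have hcB : c ∈ B := by
    rcases Finset.mem_insert.1 (g3 c hc0) with rfl | h
    exacts [absurd hXc hXy, h]
  have hB' := hB.exchange hC hcB hy hc0
  have h := hB'.eq_mul_fundCircuit hC hX (x := x) (fun f hf => by
    have h1 := hXB f hf
    have h2 : f ≠ c := fun e => hf (e ▸ hXc)
    simp only [Finset.mem_insert, Finset.mem_erase] at *
    tauto) (by simp [hx, hxy])
  have h1 := mul_mem_hadd (a := X x) (hB.fundCircuit_exchange_mem hC hcB hy hc0 hx hxy b)
  have h2 := h.2 y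
  rw [hB.fundCircuit_exchange_new hC hcB hy hc0 hx hxy] at h2
  have h3 : X x * -(fundCircuit C B y b * fundCircuit C B x c * (fundCircuit C B y c)⁻¹) =
      X y * fundCircuit C B y b := by
    rw [h2, mul_neg, mul_neg, neg_mul]
    congr 1
    field_simp
  rw [← h.2 b, h3] at h1
  rw [e1, Finset.sum_insert (by simp [hbx, hby]), Finset.sum_pair hxy, zero_mem_add_iff]
  refine ⟨_, rfl, ?_⟩
  rw [fundCocircuit_self, mul_one, hc x hbx.symm, hc y hby.symm, singleton_add_singleton, mul_neg,
    mul_neg]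
  exact neg_mem_hadd h1

include hC in
/-- The circuits of a weak matroid over a doubly distributive hyperfield are orthogonal to its
fundamental cocircuits. -/
theorem IsWeakMatroid.perp_fundCocircuit (hF : IsDoublyDistributive F) {X : E → F} (hX : X ∈ C)
    {B : Finset E} (hB : IsBase C B) {b : E} (hb : b ∈ B) :
    (0 : F) ∈ ∑ f, ({X f * fundCocircuit C B b f} : Set F) := by
  classical
  induction hm : (Finset.univ.filter fun f => X f ≠ 0 ∧ f ∉ B.erase b).card using
    Nat.strong_induction_on generalizing X B b with
  | _ m ih =>
  -- If X b = 0, exchange b for an element p of both supports. This keeps B - b, and with it the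
  -- induction measure, and rescales the cocircuit.
  wlog hXb : X b ≠ 0 generalizing B b with hwlog
  · by_cases hall : ∀ f, X f * fundCocircuit C B b f = 0
    · have : ∑ f, ({X f * fundCocircuit C B b f} : Set F) =
          ∑ f ∈ ∅, {X f * fundCocircuit C B b f} :=
        sum_singleton_eq_of_subset _ (Finset.empty_subset _) fun i _ _ => hall i
      rw [this]
      exact rfl
    push Not at hall hXb
    obtain ⟨p, hp⟩ := hall
    have hXp := left_ne_zero_of_mul hp
    have hYp := right_ne_zero_of_mul hp
    have hpb : p ≠ b := fun e => hXp (e ▸ hXb)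
    have hpB : p ∉ B := fun h => hYp (fundCocircuit_of_mem C h hpb)
    have hpb0 : fundCircuit C B p b ≠ 0 := by
      intro h0
      apply hYp
      have : fundCocircuit C B b p = -fundCircuit C B p b := if_neg hpb
      rw [this, h0, neg_zero]
    have herase : (insert p (B.erase b)).erase p = B.erase b :=
      Finset.erase_insert (by simp [hpB])
    have := hwlog (hB.exchange hC hb hpB hpb0) (b := p) (by simp) (by rwa [herase]) hXp
    have := mul_mem_sum (fundCocircuit C B b p) this
    rw [mul_zero] at this
    convert this using 3 with f
    rw [hB.fundCocircuit_exchange hC hb hpB hpb0]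
    field_simp
  by_cases htwo : ∃ x ∉ B, ∃ y ∉ B, ∀ f, X f ≠ 0 → f ∈ insert x (insert y B)
  · obtain ⟨x, hx, y, hy, h⟩ := htwo
    exact hC.perp_fundCocircuit_of_card_le_two hX hB hb hx hy h
  push Not at htwo
  obtain ⟨x, hXx, hx⟩ := hB.indep X hX
  obtain ⟨y, hXy, hy⟩ := htwo x hx x hx
  simp only [Finset.mem_insert, not_or] at hy
  obtain ⟨z, hXz, hz⟩ := htwo x hx y hy.2.2
  simp only [Finset.mem_insert, not_or] at hz
  have hbx : b ≠ x := fun e => hx (e ▸ hb)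
  have hby : b ≠ y := fun e => hy.2.2 (e ▸ hb)
  have hbz : b ≠ z := fun e => hz.2.2 (e ▸ hb)
  have hm4 : 3 < m := by
    have hsub : ({b, x, y, z} : Finset E) ⊆
        Finset.univ.filter fun f => X f ≠ 0 ∧ f ∉ B.erase b := by
      intro f hf
      simp only [Finset.mem_insert, Finset.mem_singleton] at hf
      rcases hf with rfl | rfl | rfl | rfl <;> simp [*]
    have hcard := Finset.card_le_card hsub
    rw [Finset.card_insert_of_notMem (by simp [hbx, hby, hbz]),
      Finset.card_insert_of_notMem (by simp [Ne.symm hy.1, Ne.symm hz.1]),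
      Finset.card_pair (Ne.symm hz.2.1)] at hcard
    omega
  obtain ⟨g1, g2, g3⟩ := hB.fundCircuit_spec hx
  obtain ⟨j, hj0, hXj⟩ : ∃ j, fundCircuit C B x j ≠ 0 ∧ X j = 0 := by
    by_contra! hcon
    obtain ⟨α, hα, hαX⟩ := hC.eq_smul g1 hX hcon
    have := hαX y
    rw [hB.fundCircuit_eq_zero hy.1 hy.2.2] at this
    exact mul_ne_zero hα hXy this.symm
  have hjB : j ∈ B := by
    rcases Finset.mem_insert.1 (g3 j hj0) with rfl | h
    exacts [absurd hXj hXx, h]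
  have hjb : j ≠ b := fun e => hXb (e ▸ hXj)
  -- Contract L and restrict to the support of X. In this minor {b, x} is a base, with j replaced by
  -- x, and the cocircuit of b vanishes on L.
  set L := (B.erase b).erase j with hLdef
  have hxL : x ∉ L := by simp [hLdef, hx]
  have hbL : b ∉ L := by simp [hLdef]
  set ι : {f // X f ≠ 0 ∧ f ∉ L} ↪ E := Function.Embedding.subtype _ with hι
  have hιL : ∀ e, ι e ∉ L := fun e => e.2.2
  have hιX : ∀ e, X (ι e) ≠ 0 := fun e => e.2.1
  have hrange : ∀ f, X f ≠ 0 → f ∉ L → f ∈ Set.range ι := fun f h1 h2 => ⟨⟨f, h1, h2⟩, rfl⟩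
  -- A fundamental circuit of the rank-two minor has at most three elements off L, while m > 3, so
  -- the induction hypothesis covers it.
  have hcirc : ∀ B₁ : Finset {f // X f ≠ 0 ∧ f ∉ L}, IsBase C (B₁.map ι ∪ L) → B₁.card = 2 →
      ∀ e, ∀ J : Finset E, L ⊆ J → (Finset.univ.filter fun f =>
        fundCircuit C (B₁.map ι ∪ L) (ι e) f ≠ 0 ∧ f ∉ J).card < m := by
    intro B₁ hB₁ hcard e J hJ
    have hsub : (Finset.univ.filter fun f =>
        fundCircuit C (B₁.map ι ∪ L) (ι e) f ≠ 0 ∧ f ∉ J) ⊆ insert (ι e) (B₁.map ι) := by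
      intro f hf
      rw [Finset.mem_filter] at hf
      by_contra hcon
      rw [Finset.mem_insert, not_or] at hcon
      refine hf.2.1 (hB₁.fundCircuit_eq_zero hcon.1 ?_)
      rw [Finset.mem_union, not_or]
      exact ⟨hcon.2, fun h => hf.2.2 (hJ h)⟩
    have h1 := Finset.card_le_card hsub
    have h2 := Finset.card_insert_le (ι e) (B₁.map ι)
    rw [Finset.card_map] at h2
    omega
  have hsubJ : ∀ B₁ : Finset {f // X f ≠ 0 ∧ f ∉ L}, ∀ b, L ⊆ (B₁.map ι ∪ L).erase (ι b) := by
    intro B₁ b f hf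
    refine Finset.mem_erase.2 ⟨fun e => hιL b (e ▸ hf), Finset.mem_union_right _ hf⟩
  refine hC.perp_of_minor hF ι L hιL 2 ?_ ?_ ?_ ?_ ?_ ?_
  · refine ⟨{⟨b, hXb, hbL⟩, ⟨x, hXx, hxL⟩}, ?_, Finset.card_pair (by simpa using hbx)⟩
    convert hB.exchange hC hjB hx hj0 using 1
    ext f
    simp only [hLdef, hι, Finset.map_insert, Finset.map_singleton, Function.Embedding.coe_subtype,
      Finset.mem_union, Finset.mem_insert, Finset.mem_singleton, Finset.mem_erase]
    constructor
    · rintro ((rfl | rfl) | h)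
      exacts [Or.inr ⟨hjb.symm, hb⟩, Or.inl rfl, Or.inr ⟨h.1, h.2.2⟩]
    · rintro (rfl | h)
      · exact Or.inl (Or.inr rfl)
      · by_cases hfb : f = b
        exacts [Or.inl (Or.inl hfb), Or.inr ⟨h.1, hfb, h.2⟩]
  · intro B₁ hB₁ hk₁ e he B₂ hB₂ hk₂ b' hb'
    exact ih _ (hcirc B₁ hB₁ hk₁ e _ (hsubJ B₂ b'))
      (hB₁.fundCircuit_spec (by rwa [map_mem_union_iff ι hιL])).1 hB₂
      (by rwa [map_mem_union_iff ι hιL]) rfl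
  · intro f hf hfL
    by_contra h
    exact hf (hrange f h hfL)
  · intro f hf
    rw [hLdef, Finset.mem_erase, Finset.mem_erase] at hf
    exact fundCocircuit_of_mem C hf.2.2 hf.2.1
  · intro B₁ hB₁ hk₁ b' hb'
    refine ih _ ?_ hX hB₁ (by rwa [map_mem_union_iff ι hιL]) rfl
    -- The second base element p belongs to the support of X. It leaves the measured set, whereas L
    -- loses only j, where X vanishes; the measure of X therefore drops.
    obtain ⟨p, hp, hpb⟩ := Finset.exists_mem_ne (by omega : 1 < B₁.card) b'
    rw [← hm]
    refine Finset.card_lt_card (Finset.ssubset_iff_of_subset ?_ |>.2 ⟨ι p, ?_, ?_⟩)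
    · intro f hf
      rw [Finset.mem_filter] at hf ⊢
      refine ⟨Finset.mem_univ _, hf.2.1, fun h => hf.2.2 (hsubJ B₁ b' ?_)⟩
      exact Finset.mem_erase.2 ⟨fun e => hf.2.1 (e ▸ hXj), h⟩
    · rw [Finset.mem_filter]
      refine ⟨Finset.mem_univ _, hιX p, fun h => hιL p ?_⟩
      exact Finset.mem_erase.2 ⟨fun e => hιX p (e ▸ hXj), h⟩
    · rw [Finset.mem_filter]
      intro h
      exact h.2.2 (Finset.mem_erase.2 ⟨ι.injective.ne hpb, by rwa [map_mem_union_iff ι hιL]⟩)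
  · intro B₁ hB₁ hk₁ e he
    exact ih _ (hcirc B₁ hB₁ hk₁ e _ (Finset.erase_subset _ _))
      (hB₁.fundCircuit_spec (by rwa [map_mem_union_iff ι hιL])).1 hB hb rfl

end Orthogonality

/-! ### Modular pairs and heights -/

section Modular

variable {E : Type v} {S : Set (Set E)}

theorem empty_mem_unionsOf : ∅ ∈ unionsOf S := ⟨∅, Set.empty_subset _, by simp⟩

theorem mem_unionsOf {A : Set E} (hA : A ∈ S) : A ∈ unionsOf S :=
  ⟨{A}, by simpa using hA, by simp⟩

theorem union_mem_unionsOf {A B : Set E} (hA : A ∈ unionsOf S) (hB : B ∈ unionsOf S) :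
    A ∪ B ∈ unionsOf S := by
  obtain ⟨T, hT, rfl⟩ := hA
  obtain ⟨T', hT', rfl⟩ := hB
  exact ⟨T ∪ T', Set.union_subset hT hT', (Set.sUnion_union T T').symm⟩

theorem exists_mem_of_mem_unionsOf {A : Set E} (hA : A ∈ unionsOf S) {e : E} (he : e ∈ A) :
    ∃ B ∈ S, e ∈ B ∧ B ⊆ A := by
  obtain ⟨T, hT, rfl⟩ := hA
  obtain ⟨B, hB, heB⟩ := he
  exact ⟨B, hT hB, heB, Set.subset_sUnion_of_mem hB⟩

/-- A modular pair of incomparable sets is a modular family. -/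
theorem IsModularPair.isModularFamily {A B : Set E} (h : IsModularPair S A B) (hAB : ¬ A ⊆ B)
    (hA : A.Nonempty) (hBA : ¬ B ⊆ A) : IsModularFamily S {A, B} := by
  obtain ⟨hAS, hBS, hne, hmod⟩ := h
  have hT : ({A, B} : Set (Set E)) ⊆ S := by
    rintro _ (rfl | rfl)
    exacts [hAS, hBS]
  have hmem : ⋃₀ ({A, B} : Set (Set E)) ∈ unionsOf S := ⟨_, hT, rfl⟩
  refine ⟨hT, hmem, ?_⟩
  rw [Set.encard_pair hne]
  have hU : ⋃₀ ({A, B} : Set (Set E)) = A ∪ B := Set.sUnion_pair A B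
  apply le_antisymm
  · have : ((2 : ℕ) : ℕ∞) = 2 := rfl
    rw [← this, Order.height_le_coe_iff]
    intro y hy
    have h2 : Order.height y ≤ ((1 : ℕ) : ℕ∞) := by
      rw [Order.height_le_coe_iff]
      intro z hz
      have h3 : Order.height z = 0 := by
        rw [Order.height_eq_zero]
        by_contra hmin
        rw [not_isMin_iff] at hmin
        obtain ⟨w, hw⟩ := hmin
        obtain ⟨a, haz, -⟩ := Set.exists_of_ssubset (show w.1 ⊂ z.1 from hw)
        obtain ⟨S₁, hS₁, -, hS₁z⟩ := exists_mem_of_mem_unionsOf z.2 haz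
        obtain ⟨b, hby, hbz⟩ := Set.exists_of_ssubset (show z.1 ⊂ y.1 from hz)
        obtain ⟨S₂, hS₂, hbS₂, hS₂y⟩ := exists_mem_of_mem_unionsOf y.2 hby
        -- A chain w < z < y below A ∪ B yields a member S₁ inside z and a member S₂ inside y but
        -- not inside z, two distinct members with union properly inside A ∪ B.
        refine hmod ⟨S₁, hS₁, S₂, hS₂, fun e => hbz (hS₁z (e ▸ hbS₂)), ?_⟩
        rw [← hU]
        exact lt_of_le_of_lt (Set.union_subset (hS₁z.trans hz.le) hS₂y) hy
      rw [h3]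
      exact Nat.cast_pos.2 one_pos
    exact lt_of_le_of_lt h2 (by exact_mod_cast one_lt_two)
  · have h1 : (⟨∅, empty_mem_unionsOf⟩ : unionsOf S) < ⟨A, mem_unionsOf hAS⟩ :=
      Set.empty_ssubset.2 hA
    have h2 : (⟨A, mem_unionsOf hAS⟩ : unionsOf S) < ⟨⋃₀ {A, B}, hmem⟩ := by
      change A ⊂ ⋃₀ {A, B}
      rw [hU, Set.ssubset_iff_subset_ne]
      exact ⟨Set.subset_union_left, fun e => hBA (by rw [e]; exact Set.subset_union_right)⟩
    have h3 := Order.height_add_one_le h1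
    have h4 := Order.height_add_one_le h2
    calc (2 : ℕ∞) = 0 + 1 + 1 := by norm_num
      _ ≤ Order.height (⟨∅, empty_mem_unionsOf⟩ : unionsOf S) + 1 + 1 := by gcongr; exact zero_le
      _ ≤ _ := (add_le_add_left h3 1).trans h4

end Modular

/-! ### Equivalence of weak and strong matroids -/

section WeakStrong

variable {F : Type u} [Hyperfield F] {E : Type v} {C : Set (E → F)}

theorem IsStrongMatroid.isWeakMatroid (hC : IsStrongMatroid C) : IsWeakMatroid C where
  toIsCircuitSystem := hC.toIsCircuitSystem
  modular_elim X hX Y hY hXY e hXe hXe0 := by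
    have hsub : ∀ X ∈ C, ∀ Y ∈ C, Function.support X ⊆ Function.support Y →
        Function.support X = Function.support Y := by
      intro X hX Y hY h
      obtain ⟨α, hα, rfl⟩ := hC.incomparable X hX Y hY h
      exact support_smul_eq hα Y
    have hXY1 : ¬ Function.support X ⊆ Function.support Y :=
      fun h => hXY.2.2.1 (hsub X hX Y hY h)
    have hXY2 : ¬ Function.support Y ⊆ Function.support X :=
      fun h => hXY.2.2.1 (hsub Y hY X hX h).symm
    obtain ⟨Z, hZ, hZe, hf⟩ := hC.strong_modular_elim 1 X (fun _ => Y) (fun _ => e) hX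
      (fun _ => hY) (by
        rw [Set.range_const]
        exact hXY.isModularFamily hXY1 ⟨e, hXe0⟩ hXY2) (by
        rw [Set.range_const, Set.encard_pair hXY.2.2.1]
        norm_num) (by simpa using hXY1)
      (fun i => ⟨hXe, hXe0, fun j hj => absurd (Subsingleton.elim j i) hj⟩)
    refine ⟨Z, hZ, hZe 0, fun f => ?_⟩
    have := hf f
    rw [hsum_eq_sum, Multiset.map_cons, Multiset.sum_cons] at this
    simpa [singleton_add_singleton] using this

theorem IsWeakMatroid.isStrongMatroid [Finite E] (hF : IsDoublyDistributive F)
    (hC : IsWeakMatroid C) : IsStrongMatroid C where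
  toIsCircuitSystem := hC.toIsCircuitSystem
  strong_modular_elim k X Y e hX hY hmod hcard hnot he := by
    classical
    cases nonempty_fintype E
    obtain ⟨-, hmem, hheight⟩ := hmod
    rw [hcard] at hheight
    set U := ⋃₀ insert (Function.support X) (Set.range fun i => Function.support (Y i)) with hU
    have hUmem : ∀ f, f ∈ U ↔ X f ≠ 0 ∨ ∃ i, Y i f ≠ 0 := by
      intro f
      simp [hU]
    obtain ⟨x, hXx, hYx⟩ := Set.not_subset.1 hnot
    rw [Function.mem_support] at hXx
    simp only [Set.mem_iUnion, Function.mem_support, not_exists, not_not] at hYx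
    have hYe : ∀ i, Y i (e i) ≠ 0 := fun i h => (he i).2.1 (by rw [(he i).1, h, neg_zero])
    have hex : ∀ i, e i ≠ x := fun i h => hYe i (by rw [h]; exact hYx i)
    have hinj : Function.Injective e := by
      intro i j hij
      by_contra hne
      exact hYe i (by rw [hij]; exact (he j).2.2 i hne)
    -- The base is chosen to contain all of U except x and the e i. Then each Y i is a multiple of
    -- the fundamental circuit of e i, and the fundamental circuit of x vanishes at every e i.
    set I : Finset E := Finset.univ.filter fun f => f ∈ U ∧ f ≠ x ∧ ∀ i, f ≠ e i with hI
    have hIindep : ∀ Z ∈ C, ∃ f, Z f ≠ 0 ∧ f ∉ I := by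
      by_contra! hcon
      obtain ⟨Z, hZ, hZI⟩ := hcon
      have hZI' : ∀ f, Z f ≠ 0 → f ∈ U ∧ f ≠ x ∧ ∀ i, f ≠ e i := fun f hf => by
        simpa [hI] using hZI f hf
      -- A circuit Z inside I would start the chain ∅ < Z < Z ∪ Y₁ < ⋯ < Z ∪ Y₁ ∪ ⋯ ∪ Yₖ < U: each Y
      -- i adds e i and the last step adds x. That makes the height of U at least k + 2, against k +
      -- 1.
      have hchain : ∀ n ≤ k, ∃ A : unionsOf (suppSet C), ((n + 1 : ℕ) : ℕ∞) ≤ Order.height A ∧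
          ∀ f, f ∈ A.1 ↔ Z f ≠ 0 ∨ ∃ i : Fin k, i.1 < n ∧ Y i f ≠ 0 := by
        intro n
        induction n with
        | zero =>
          intro _
          refine ⟨⟨Function.support Z, mem_unionsOf ⟨Z, hZ, rfl⟩⟩, ?_, by simp⟩
          have h1 : (⟨∅, empty_mem_unionsOf⟩ : unionsOf (suppSet C)) <
              ⟨Function.support Z, mem_unionsOf ⟨Z, hZ, rfl⟩⟩ :=
            Set.empty_ssubset.2 (hC.exists_ne_zero hZ)
          refine le_trans ?_ (Order.height_add_one_le h1)
          simp
        | succ n ih =>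
          intro hn
          obtain ⟨A, hA, hAmem⟩ := ih (by omega)
          have hB : A.1 ∪ Function.support (Y ⟨n, hn⟩) ∈ unionsOf (suppSet C) :=
            union_mem_unionsOf A.2 (mem_unionsOf ⟨_, hY _, rfl⟩)
          refine ⟨⟨_, hB⟩, ?_, ?_⟩
          · have h1 : A < ⟨_, hB⟩ := by
              change A.1 ⊂ A.1 ∪ Function.support (Y ⟨n, hn⟩)
              refine (Set.ssubset_iff_of_subset Set.subset_union_left).2
                ⟨e ⟨n, hn⟩, Or.inr (hYe _), fun h => ?_⟩
              rcases (hAmem _).1 h with h | ⟨i, hi, h⟩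
              · exact (hZI' _ h).2.2 _ rfl
              · exact h ((he _).2.2 i (Fin.ne_of_val_ne hi.ne))
            refine le_trans ?_ (Order.height_add_one_le h1)
            rw [Nat.cast_add, Nat.cast_one]
            gcongr
          · intro f
            rw [Set.mem_union, hAmem, Function.mem_support]
            constructor
            · rintro ((h | ⟨i, hi, h⟩) | h)
              exacts [Or.inl h, Or.inr ⟨i, by omega, h⟩, Or.inr ⟨_, Nat.lt_succ_self n, h⟩]
            · rintro (h | ⟨i, hi, h⟩)
              · exact Or.inl (Or.inl h)
              · rcases Nat.lt_succ_iff_lt_or_eq.1 hi with hi | hi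
                · exact Or.inl (Or.inr ⟨i, hi, h⟩)
                · refine Or.inr ?_
                  have : i = ⟨n, hn⟩ := Fin.ext hi
                  rwa [← this]
      obtain ⟨A, hA, hAmem⟩ := hchain k le_rfl
      have h1 : A < ⟨U, hmem⟩ := by
        change A.1 ⊂ U
        refine (Set.ssubset_iff_of_subset fun f hf => ?_).2 ⟨x, (hUmem x).2 (Or.inl hXx), ?_⟩
        · rcases (hAmem f).1 hf with h | ⟨i, -, h⟩
          exacts [(hZI' f h).1, (hUmem f).2 (Or.inr ⟨i, h⟩)]
        · rw [hAmem]
          rintro (h | ⟨i, -, h⟩)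
          exacts [(hZI' x h).2.1 rfl, h (hYx i)]
      have h2 := (add_le_add_left hA 1).trans (Order.height_add_one_le h1)
      rw [hheight] at h2
      have h3 : k + 1 + 1 ≤ k + 1 := by exact_mod_cast h2
      omega
    obtain ⟨B, hB, hIB⟩ := hC.exists_isBase hIindep
    have hYB : ∀ i f, Y i f ≠ 0 → f ∈ insert (e i) B := by
      intro i f hf
      rw [Finset.mem_insert]
      by_cases hfe : f = e i
      · exact Or.inl hfe
      refine Or.inr (hIB ?_)
      simp only [hI, Finset.mem_filter, Finset.mem_univ, true_and]
      refine ⟨(hUmem f).2 (Or.inr ⟨i, hf⟩), fun h => hf (h ▸ hYx i), fun j hj => ?_⟩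
      subst hj
      exact hf ((he j).2.2 i fun h => hfe (by rw [h]))
    have heB : ∀ i, e i ∉ B := by
      intro i hi
      obtain ⟨f, hf, hfB⟩ := hB.indep _ (hY i)
      rcases Finset.mem_insert.1 (hYB i f hf) with rfl | h
      exacts [hfB hi, hfB h]
    have hYfund : ∀ i f, Y i f = Y i (e i) * fundCircuit C B (e i) f := fun i =>
      (hB.eq_mul_fundCircuit hC (hY i) (hYB i) (heB i)).2
    have hXB : ∀ f, f ∉ B → f ≠ x → (∀ i, f ≠ e i) → X f = 0 := by
      intro f hfB hfx hfe
      by_contra h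
      exact hfB (hIB (by simp [hI, hUmem, h, hfx, hfe]))
    -- Otherwise the inner product of X with the cocircuit of x has X x as its only non-zero term,
    -- since the fundamental circuits of the e i vanish at x together with the Y i.
    have hxB : x ∉ B := by
      intro hx
      have horth := hC.perp_fundCocircuit hF hX hB hx
      have : ∑ f, ({X f * fundCocircuit C B x f} : Set F) =
          ∑ f ∈ {x}, {X f * fundCocircuit C B x f} := by
        refine sum_singleton_eq_of_subset _ (Finset.subset_univ _) fun f _ hf => ?_
        rw [Finset.mem_singleton] at hf
        by_cases hfB : f ∈ B
        · rw [fundCocircuit_of_mem C hfB hf, mul_zero]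
        by_cases hfe : ∃ i, f = e i
        · obtain ⟨i, rfl⟩ := hfe
          have h0 := hYfund i x
          rw [hYx i, eq_comm, mul_eq_zero] at h0
          have : fundCocircuit C B x (e i) = -fundCircuit C B (e i) x := if_neg hf
          rw [this, h0.resolve_left (hYe i), neg_zero, mul_zero]
        · push Not at hfe
          rw [hXB f hfB hf hfe, zero_mul]
      rw [this, Finset.sum_singleton, fundCocircuit_self, mul_one] at horth
      exact hXx horth.symm
    obtain ⟨g1, g2, g3⟩ := hB.fundCircuit_spec hxB
    refine ⟨_, hC.smul_mem _ g1 _ hXx, fun i => ?_, fun f => ?_⟩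
    · rw [hB.fundCircuit_eq_zero (hex i) (heB i), mul_zero]
    rw [hsum_eq_sum, Multiset.map_cons, Multiset.sum_cons, Multiset.map_map]
    change X x * fundCircuit C B x f ∈ {X f} + ∑ i, ({Y i f} : Set F)
    by_cases hfB : f ∈ B
    · have horth := hC.perp_fundCocircuit hF hX hB hfB
      have hfx : f ≠ x := fun h => hxB (h ▸ hfB)
      have hfe : ∀ i, e i ≠ f := fun i h => heB i (h ▸ hfB)
      have e1 : ∑ g, ({X g * fundCocircuit C B f g} : Set F) =
          ∑ g ∈ insert f (insert x (Finset.univ.image e)), {X g * fundCocircuit C B f g} := by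
        refine sum_singleton_eq_of_subset _ (Finset.subset_univ _) fun g _ hg => ?_
        simp only [Finset.mem_insert, Finset.mem_image, Finset.mem_univ, true_and, not_or,
          not_exists] at hg
        by_cases hgB : g ∈ B
        · rw [fundCocircuit_of_mem C hgB hg.1, mul_zero]
        · rw [hXB g hgB hg.2.1 fun i h => hg.2.2 i h.symm, zero_mul]
      have e2 : fundCocircuit C B f x = -fundCircuit C B x f := if_neg hfx.symm
      -- The sign in X (e i) = -Y i (e i) cancels that of the cocircuit. Orthogonality then reads 0
      -- ∈ X f ⊞ -(X x * c) ⊞ ⊞ᵢ Y i f, with c the value at f of the fundamental circuit of x, which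
      -- is the claim.
      have e3 : ∀ i, X (e i) * fundCocircuit C B f (e i) = Y i f := by
        intro i
        have : fundCocircuit C B f (e i) = -fundCircuit C B (e i) f := if_neg (hfe i)
        rw [this, (he i).1, neg_mul_neg, ← hYfund i f]
      rw [e1, Finset.sum_insert (by simp [hfx, hfe]), Finset.sum_insert (by simp [hex]),
        Finset.sum_image hinj.injOn, fundCocircuit_self, mul_one, e2, mul_neg] at horth
      simp only [e3] at horth
      rw [add_left_comm, zero_mem_add_iff] at horth
      obtain ⟨z, rfl, hz⟩ := horth
      rwa [neg_neg] at hz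
    by_cases hfx : f = x
    · subst hfx
      rw [g2, mul_one]
      simp only [hYx]
      simp only [← set_zero_eq, Finset.sum_const_zero, add_zero]
      rfl
    rw [hB.fundCircuit_eq_zero hfx hfB, mul_zero]
    by_cases hfe : ∃ i, f = e i
    · obtain ⟨i, rfl⟩ := hfe
      rw [Finset.sum_eq_single i (fun j _ hj => by rw [(he i).2.2 j hj]; rfl) (by simp),
        singleton_add_singleton, zero_mem_hadd_iff, (he i).1, neg_neg]
    · push Not at hfe
      have hY0 : ∀ i, Y i f = 0 := by
        intro i
        by_contra h
        rcases Finset.mem_insert.1 (hYB i f h) with h | h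
        exacts [hfe i h, hfB h]
      simp only [hY0, hXB f hfB hfx hfe]
      simp only [← set_zero_eq, Finset.sum_const_zero, add_zero]
      rfl

end WeakStrong

/-! ### Involutions and perfection -/

namespace HyperInvolution

variable {F : Type u} [Hyperfield F] (τ : HyperInvolution F)

theorem map_eq_zero_iff {x : F} : τ.toFun x = 0 ↔ x = 0 :=
  ⟨fun h => τ.involutive.injective (h.trans τ.map_zero.symm), fun h => h ▸ τ.map_zero⟩

theorem map_mem_sum {ι : Type*} {s : Finset ι} {f : ι → F} {z : F}
    (h : z ∈ ∑ i ∈ s, ({f i} : Set F)) : τ.toFun z ∈ ∑ i ∈ s, ({τ.toFun (f i)} : Set F) := by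
  classical
  induction s using Finset.induction_on generalizing z with
  | empty =>
    have : z = 0 := h
    rw [this, τ.map_zero]
    exact rfl
  | insert i s hi ih =>
    rw [Finset.sum_insert hi] at h ⊢
    obtain ⟨y, hy, hz⟩ := mem_singleton_add.1 h
    exact mem_singleton_add.2 ⟨_, ih hy, (τ.map_hadd _ _).subset ⟨z, hz, rfl⟩⟩

end HyperInvolution

section Perfect

variable {F : Type u} [Hyperfield F] (τ : HyperInvolution F) {E : Type v} [Fintype E]

theorem orthogonal_iff {X Y : E → F} :
    Orthogonal τ X Y ↔ (0 : F) ∈ ∑ e, ({X e * τ.toFun (Y e)} : Set F) := by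
  rw [Orthogonal, hsum_map_eq_sum]

theorem orthogonal_symm {X Y : E → F} (h : Orthogonal τ X Y) : Orthogonal τ Y X := by
  rw [orthogonal_iff] at *
  have := τ.map_mem_sum h
  simpa only [τ.map_zero, τ.map_mul, τ.involutive _, mul_comm] using this

theorem eq_zero_of_zero_mem_sum {g : E → F} (x : E) (hg : ∀ f, f ≠ x → g f = 0)
    (h : (0 : F) ∈ ∑ f, ({g f} : Set F)) : g x = 0 := by
  rw [sum_singleton_eq_of_subset (s := {x}) _ (Finset.subset_univ _)
    fun i _ hi => hg i (by simpa using hi), Finset.sum_singleton] at h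
  exact h.symm

/-- For minimality, let Z be non-zero, orthogonal to the circuits, with support inside the
cocircuit. Each fundamental circuit of an f in that support meets the cocircuit only in b and f, so
Z cannot vanish at just one of them; and if Z b = 0, then Z = 0. -/
theorem IsWeakMatroid.map_fundCocircuit_mem_cocircuits [DecidableEq E] {C : Set (E → F)}
    (hC : IsWeakMatroid C) (hF : IsDoublyDistributive F) {B : Finset E} (hB : IsBase C B) {b : E}
    (hb : b ∈ B) : (fun f => τ.toFun (fundCocircuit C B b f)) ∈ cocircuits τ C := by
  refine ⟨⟨fun X hX => ?_, fun h => ?_⟩, fun Z hZ hsub => ?_⟩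
  · rw [orthogonal_iff]
    have := τ.map_mem_sum (hC.perp_fundCocircuit hF hX hB hb)
    simpa only [τ.map_zero, τ.map_mul, mul_comm] using this
  · have := congrFun h b
    simp only [fundCocircuit_self, τ.map_one] at this
    exact one_ne_zero this
  · obtain ⟨hZC, hZ0⟩ := hZ
    have hsub' : ∀ f, fundCocircuit C B b f = 0 → Z f = 0 := by
      intro f hf
      by_contra h
      have := hsub h
      rw [Function.mem_support, hf] at this
      exact this τ.map_zero
    have hperp : ∀ x ∉ B, (0 : F) ∈ ∑ f, ({Z f * τ.toFun (fundCircuit C B x f)} : Set F) :=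
      fun x hx => (orthogonal_iff τ).1 (hZC _ (hB.fundCircuit_spec hx).1)
    have hZB : ∀ f ∈ B, f ≠ b → Z f = 0 := fun f hf hfb =>
      hsub' f (fundCocircuit_of_mem C hf hfb)
    have hZb : Z b ≠ 0 := by
      intro hZb
      apply hZ0
      funext x
      by_cases hx : x ∈ B
      · by_cases hxb : x = b
        exacts [hxb ▸ hZb, hZB x hx hxb]
      have := eq_zero_of_zero_mem_sum x (fun f hfx => ?_) (hperp x hx)
      · rwa [(hB.fundCircuit_spec hx).2.1, τ.map_one, mul_one] at this
      · by_cases hf : f ∈ B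
        · by_cases hfb : f = b
          · rw [hfb, hZb, zero_mul]
          · rw [hZB f hf hfb, zero_mul]
        · rw [hB.fundCircuit_eq_zero hfx hf, τ.map_zero, mul_zero]
    intro f hf
    have hYf : fundCocircuit C B b f ≠ 0 := fun h => hf (τ.map_eq_zero_iff.2 h)
    by_cases hfb : f = b
    · rw [hfb]; exact hZb
    have hfB : f ∉ B := fun h => hYf (fundCocircuit_of_mem C h hfb)
    intro hZf
    have := eq_zero_of_zero_mem_sum b (fun g hg => ?_) (hperp f hfB)
    · have := τ.map_eq_zero_iff.1 ((mul_eq_zero.1 this).resolve_left hZb)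
      apply hYf
      rw [fundCocircuit, if_neg hfb, this, neg_zero]
    · by_cases hgB : g ∈ B
      · rw [hZB g hgB hg, zero_mul]
      · by_cases hgf : g = f
        · rw [hgf, hZf, zero_mul]
        · rw [hB.fundCircuit_eq_zero hgf hgB, τ.map_zero, mul_zero]

end Perfect

theorem IsDoublyDistributive.isPerfect {F : Type u} [Hyperfield F] (hF : IsDoublyDistributive F)
    (τ : HyperInvolution F) : IsPerfect.{u, v} F τ := by
  intro E _ C hstrong V hV W hW
  classical
  have hC := hstrong.isWeakMatroid
  obtain ⟨B₀, hB₀, -⟩ := hC.exists_isBase (I := ∅)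
    fun X hX => (hC.exists_ne_zero hX).imp fun e he => ⟨he, by simp⟩
  have hmap : ∀ B : Finset E, B.map (Function.Embedding.refl E) ∪ ∅ = B := fun B => by
    rw [Finset.map_refl, Finset.union_empty]
  rw [orthogonal_iff]
  -- The trivial minor. Only bases of the size of B₀ are used, so that equicardinality of bases is
  -- not needed. W is conjugated because the orthogonality in the minor carries no involution.
  refine hC.perp_of_minor hF (Function.Embedding.refl E) ∅ (by simp) B₀.card
    ⟨B₀, by rwa [hmap], rfl⟩ ?_ (W := fun f => τ.toFun (W f)) (by simp) (by simp) ?_ ?_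
  all_goals simp only [hmap, Function.Embedding.refl_apply]
  · intro B hB _ e he B' hB' _ b hb
    exact hC.perp_fundCocircuit hF (hB.fundCircuit_spec he).1 hB' hb
  · intro B hB _ b hb
    have := (orthogonal_iff τ).1 (hV _ (hC.map_fundCocircuit_mem_cocircuits τ hF hB hb))
    simpa only [τ.involutive _] using this
  · intro B hB _ e he
    exact (orthogonal_iff τ).1 (orthogonal_symm τ (hW _ (hB.fundCircuit_spec he).1))

/-! ### The Krasner, sign and tropical hyperfields -/

section Examples

/-- The product is contained in the four-term hypersum in every hyperfield, by distributivity
applied twice; only the converse needs checking. -/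
theorem isDoublyDistributive_of_exists {F : Type u} [Hyperfield F]
    (h : ∀ x y z t p : F, p ∈ hadd (x * z) (x * t) → ∀ q, q ∈ hadd (y * z) (y * t) →
      ∀ w, w ∈ hadd p q → ∃ a ∈ hadd x y, ∃ b ∈ hadd z t, a * b = w) : IsDoublyDistributive F := by
  intro x y z t
  have e : hsum {x * z, x * t, y * z, y * t} = hadd (x * z) (x * t) + hadd (y * z) (y * t) := by
    rw [hsum_eq_sum]
    simp only [Multiset.insert_eq_cons, Multiset.map_cons, Multiset.map_singleton,
      Multiset.sum_cons, Multiset.sum_singleton, ← singleton_add_singleton]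
    abel
  rw [e]
  ext w
  constructor
  · rintro ⟨a, ha, b, hb, rfl⟩
    refine ⟨x * b, mul_mem_hadd hb, y * b, mul_mem_hadd hb, ?_⟩
    change a * b ∈ _
    rw [mul_comm x, mul_comm y, mul_comm a]
    exact mul_mem_hadd ha
  · rintro ⟨p, hp, q, hq, hw⟩
    exact h x y z t p hp q hq w hw

theorem krasnerHyperfield_isDoublyDistributive :
    @IsDoublyDistributive (ZMod 2) krasnerHyperfield := by
  let _ := krasnerHyperfield
  have hh : ∀ x y z : ZMod 2, z ∈ hadd x y ↔ x = 0 ∧ z = y ∨ y = 0 ∧ z = x ∨ x = 1 ∧ y = 1 :=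
    fun _ _ _ => Iff.rfl
  refine isDoublyDistributive_of_exists ?_
  simp only [hh]
  set_option synthInstance.maxHeartbeats 400000 in set_option synthInstance.maxSize 4000 in decide

theorem signHyperfield_isDoublyDistributive :
    @IsDoublyDistributive SignType signHyperfield := by
  let _ := signHyperfield
  have hh : ∀ x y z : SignType, z ∈ hadd x y ↔
      x = 0 ∧ z = y ∨ y = 0 ∧ z = x ∨ x ≠ 0 ∧ y ≠ 0 ∧ (x = y → z = x) := fun _ _ _ => Iff.rfl
  refine isDoublyDistributive_of_exists ?_
  simp only [hh]
  set_option synthInstance.maxHeartbeats 400000 in set_option synthInstance.maxSize 4000 in decide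

theorem tropicalHyperfield_isDoublyDistributive :
    @IsDoublyDistributive NNReal tropicalHyperfield := by
  let _ := tropicalHyperfield
  have hh : ∀ x y z : NNReal, z ∈ hadd x y ↔ x ≠ y ∧ z = max x y ∨ x = y ∧ z ≤ x :=
    fun _ _ _ => Iff.rfl
  refine isDoublyDistributive_of_exists ?_
  have hle : ∀ {x y z : NNReal}, z ∈ hadd x y → z ≤ max x y := by
    intro x y z hz
    rcases (hh x y z).1 hz with ⟨-, h⟩ | ⟨-, h⟩
    exacts [h.le, h.trans (le_max_left _ _)]
  have hmax : ∀ x y : NNReal, max x y ∈ hadd x y := by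
    intro x y
    rw [hh]
    by_cases h : x = y
    · right; simp [h]
    · left; exact ⟨h, rfl⟩
  have hmul : ∀ x z t p : NNReal, z ≠ t → p ∈ hadd (x * z) (x * t) → p = x * max z t := by
    intro x z t p hzt hp
    by_cases hx : x = 0
    · have := hle hp
      simpa [hx] using this
    · rcases (hh _ _ p).1 hp with ⟨-, h⟩ | ⟨h, -⟩
      · rw [h, mul_max_of_nonneg _ _ (zero_le : 0 ≤ x)]
      · exact absurd (mul_left_cancel₀ hx h) hzt
  -- If x = y or z = t, one factor is a full interval [0, x] or [0, z], and multiplying it by the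
  -- maximum of the other factor reaches every value up to the bound.
  have hself : ∀ x m w : NNReal, w ≤ x * m → ∃ a ∈ hadd x x, a * m = w := by
    intro x m w hw
    by_cases hm : m = 0
    · refine ⟨x, by simpa using hmax x x, ?_⟩
      rw [hm, mul_zero] at hw ⊢
      exact (le_antisymm hw zero_le).symm
    · refine ⟨w / m, (hh _ _ _).2 (Or.inr ⟨rfl, ?_⟩), div_mul_cancel₀ w hm⟩
      exact div_le_of_le_mul₀ zero_le zero_le hw
  intro x y z t p hp q hq w hw
  have hpm : p ≤ x * max z t := by
    rw [mul_max_of_nonneg _ _ (zero_le : 0 ≤ x)]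
    exact hle hp
  have hqm : q ≤ y * max z t := by
    rw [mul_max_of_nonneg _ _ (zero_le : 0 ≤ y)]
    exact hle hq
  have hwm : w ≤ max x y * max z t := by
    rw [max_mul_of_nonneg _ _ (zero_le : 0 ≤ max z t)]
    exact (hle hw).trans (max_le_max hpm hqm)
  by_cases hxy : x = y
  · subst hxy
    rw [max_self] at hwm
    obtain ⟨a, ha, h⟩ := hself x _ w hwm
    exact ⟨a, ha, _, hmax z t, h⟩
  by_cases hzt : z = t
  · subst hzt
    rw [max_self, mul_comm] at hwm
    obtain ⟨a, ha, h⟩ := hself z _ w hwm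
    exact ⟨_, hmax x y, a, ha, (mul_comm _ _).trans h⟩
  -- With x ≠ y and z ≠ t, both p and q are forced and distinct, so w is the product of the two
  -- maxima.
  refine ⟨_, hmax x y, _, hmax z t, ?_⟩
  have hp' := hmul x z t p hzt hp
  have hq' := hmul y z t q hzt hq
  have hm : max z t ≠ 0 := by
    intro h
    have h1 : z ≤ 0 := h ▸ le_max_left z t
    have h2 : t ≤ 0 := h ▸ le_max_right z t
    exact hzt ((le_antisymm h1 zero_le).trans (le_antisymm h2 zero_le).symm)
  rcases (hh p q w).1 hw with ⟨-, h⟩ | ⟨h, -⟩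
  · rw [h, hp', hq']
    exact max_mul_of_nonneg _ _ (zero_le : 0 ≤ max z t)
  · rw [hp', hq'] at h
    exact absurd (mul_right_cancel₀ hm h) hxy

end Examples

theorem corollary5p3 :
    (∀ (F : Type u) [Hyperfield F], IsDoublyDistributive F →
      (∀ τ : HyperInvolution F, IsPerfect.{u, v} F τ) ∧
      ∀ (E : Type v) [Finite E] (C : Set (E → F)), IsWeakMatroid C ↔ IsStrongMatroid C) ∧
    @IsDoublyDistributive (ZMod 2) krasnerHyperfield ∧
    @IsDoublyDistributive SignType signHyperfield ∧
    @IsDoublyDistributive NNReal tropicalHyperfield :=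
  ⟨fun _ _ hF => ⟨fun τ => hF.isPerfect τ,
    fun _ _ _ => ⟨fun hC => hC.isStrongMatroid hF, fun hC => hC.isWeakMatroid⟩⟩,
    krasnerHyperfield_isDoublyDistributive, signHyperfield_isDoublyDistributive,
    tropicalHyperfield_isDoublyDistributive⟩
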